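/- Let $n\ge 2$ and $m\ge 0$, let $I=[0,1]$, let $C=C(m,I^{n-1})$ be the space of ordered $m$-tuples of distinct points of $I^{n-1}$, and let $y=(y_1,\dots,y_m)\in C$ be a base point. For a space $X$ with base point $*$, the *geometric cobar construction* on $X$ is the cosimplicial space with $p$-th space $X^p$, cofaces $d^0(x_1,\dots,x_p)=(*,x_1,\dots,x_p)$, $d^i(x_1,\dots,x_p)=(x_1,\dots,x_i,x_i,\dots,x_p)$ for $1\le i\le p$, $d^{p+1}(x_1,\dots,x_p)=(x_1,\dots,x_p,*)$, and codegeneracies $s^i(x_1,\dots,x_p)=(x_1,\dots,x_i,x_{i+2},\dots,x_p)$. The *cosimplicial model for braids* $BR^\bullet$ has as $p$-th space the families $(x^i_j)_{1\le i\le m,\,1\le j\le p}$ of points of $I^{n-1}$ such that for each $j$ the points $x^1_j,\dots,x^m_j$ are distinct (so $BR^{[p]}=C^p$); $d^0$ and $d^{p+1}$ insert the column $y$ at the beginning and at the end, the other cofaces double a column, and the codegeneracies forget a column. The *diagonal braid model* $BR_{diag}$ has as $p$-th space the families $(x^i_j)_{1\le i\le m,\,1\le j\le p}$ of points of $I^n=I^{n-1}\times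 I$ such that for each $j$ the points $x^1_j,\dots,x^m_j$ are distinct and lie in one slice $I^{n-1}\times\{t_j\}$, and such that the last coordinates increase weakly along each strand, i.e. in $j$ for each fixed $i$; its structure maps act on all $m$ strands by the same map of the simplex category: $d^0$ inserts the column $((y_i,0))_i$ at the beginning, $d^{p+1}$ inserts the column $((y_i,1))_i$ at the end, the other cofaces double a column, and the codegeneracies forget a column. Then: 1. $BR^\bullet$ is isomorphic, as a cosimplicial space, to the geometric cobar construction on $(C,y)$, and there is a map of cosimplicial spaces from $BR_{diag}$ to the geometric cobar construction on $(C,y)$ that is a homotopy equivalence at each level; in particular $BR_{diag}^{[p]}\simeq C^p$. 2. There are homotopy equivalences $$\operatorname{Tot} BR^\bullet\;\simeq\;\operatorname{Tot} BR_{diag}\;\simeq\;\Omega C(m,I^{n-1}),$$ where $\Omega$ denotes the space of loops based at $y$. They hold both when $\operatorname{Tot} X^\bullet$ is the space of cosimplicial maps $\Delta^\bullet\to X^\bullet$ and when it is the Bousfield–Kan homotopy limit of $X^\bullet$, i.e. the space of cosimplicial maps from $[p]\mapsto |N(\Delta\downarrow[p])|$ to $X^\bullet$. -/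

import Mathlib

open CategoryTheory Simplicial Topology

noncomputable section

/-! ### Configuration spaces -/

/-- The cube `I^k`. -/
abbrev Cube (k : ℕ) : Type := Fin k → unitInterval

/-- The configuration space `C(m, Y)` of `m` (ordered) distinct points in `Y`,
with the subspace topology from `Y^m`. -/
abbrev Conf (m : ℕ) (Y : Type) : Type := {x : Fin m → Y // Function.Injective x}

/-! ### Doubling and forgetting entries of a tuple

An element `x = (x₁, …, x_p)` of `Y^p` is extended to `(a, x₁, …, x_p, b)`. One thinks of the
elements of `[p] = {0, …, p}` as `p + 1` holes in an interval; `x_j` sits between the holes `j - 1`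
and `j`, while `a` sits in front of all the holes and `b` behind all of them. -/

/-- The extended tuple `(a, x₁, …, x_p, b)`. -/
def withEnds {Y : Type} (a b : Y) {p : ℕ} (x : Fin p → Y) : Fin (p + 2) → Y :=
  Fin.cons a (Fin.snoc (α := fun _ => Y) x b)

/-- For `θ : [p] → [q]`, the number of `i ∈ [p]` with `θ i < j`, as a function of
`j ∈ {0, …, q + 1}`. -/
def gapMap {p q : SimplexCategory} (θ : p ⟶ q) (j : Fin (q.len + 2)) : Fin (p.len + 2) :=
  ⟨(Finset.univ.filter fun i : Fin (p.len + 1) => (θ.toOrderHom i : ℕ) < j).card,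
    Nat.lt_succ_of_le ((Finset.card_filter_le _ _).trans (by simp))⟩

/-- The map `Y^p → Y^q` induced by `θ : [p] → [q]`: the `j`-th entry of the image is the entry of
`(a, x₁, …, x_p, b)` whose index is the number of `i ∈ [p]` with `θ i < j`. On the generators of
the simplex category these are the maps that insert `a` at the start, double an entry, insert `b`
at the end, and forget an entry (see `act_δ_zero`, `act_δ_mid`, `act_δ_last` and `act_σ`). -/
def act {Y : Type} (a b : Y) {p q : SimplexCategory} (θ : p ⟶ q) (x : Fin p.len → Y) :
    Fin q.len → Y :=
  fun k => withEnds a b x (gapMap θ k.succ.castSucc)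

theorem withEnds_zero {Y : Type} (a b : Y) {p : ℕ} (x : Fin p → Y) : withEnds a b x 0 = a := rfl

theorem withEnds_last {Y : Type} (a b : Y) {p : ℕ} (x : Fin p → Y) :
    withEnds a b x (Fin.last (p + 1)) = b := by
  rw [withEnds, ← Fin.succ_last, Fin.cons_succ, Fin.snoc_last]

theorem withEnds_mid {Y : Type} (a b : Y) {p : ℕ} (x : Fin p → Y) (k : Fin p) :
    withEnds a b x k.succ.castSucc = x k := by
  rw [withEnds, ← Fin.succ_castSucc, Fin.cons_succ, Fin.snoc_castSucc]

/-- Every index of an extended tuple is the first one, the last one, or one in between. -/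
theorem end_cases {p : ℕ} (j : Fin (p + 2)) :
    j = 0 ∨ j = Fin.last (p + 1) ∨ ∃ k : Fin p, j = k.succ.castSucc := by
  rcases Fin.eq_castSucc_or_eq_last j with ⟨i, rfl⟩ | h
  · rcases Fin.eq_zero_or_eq_succ i with rfl | ⟨k, rfl⟩
    · exact Or.inl rfl
    · exact Or.inr (Or.inr ⟨k, rfl⟩)
  · exact Or.inr (Or.inl h)

theorem gapMap_zero {p q : SimplexCategory} (θ : p ⟶ q) : gapMap θ 0 = 0 := by
  ext; simp [gapMap]

theorem gapMap_last {p q : SimplexCategory} (θ : p ⟶ q) :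
    gapMap θ (Fin.last (q.len + 1)) = Fin.last (p.len + 1) := by
  ext
  simp only [gapMap, Fin.val_last]
  rw [Finset.filter_true_of_mem (fun i _ => (θ.toOrderHom i).isLt)]
  simp

theorem gapMap_mono {p q : SimplexCategory} (θ : p ⟶ q) : Monotone (gapMap θ) := by
  intro i j hij
  refine Fin.mk_le_mk.2 (Finset.card_le_card fun l hl => ?_)
  simp only [Finset.mem_filter, Finset.mem_univ, true_and] at hl ⊢
  exact lt_of_lt_of_le hl hij

theorem lt_gapMap_iff {p q : SimplexCategory} (θ : p ⟶ q) (j : Fin (q.len + 2))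
    (i : Fin (p.len + 1)) : (i : ℕ) < gapMap θ j ↔ (θ.toOrderHom i : ℕ) < j := by
  constructor
  · intro h
    by_contra hc
    have hsub : (Finset.univ.filter fun l : Fin (p.len + 1) => (θ.toOrderHom l : ℕ) < j) ⊆
        Finset.univ.filter fun l : Fin (p.len + 1) => (l : ℕ) < i := by
      intro l hl
      simp only [Finset.mem_filter, Finset.mem_univ, true_and] at hl ⊢
      by_contra hli
      have : θ.toOrderHom i ≤ θ.toOrderHom l := θ.toOrderHom.monotone (by omega)
      exact hc (lt_of_le_of_lt this hl)
    have := Finset.card_le_card hsub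
    rw [Fin.card_filter_val_lt] at this
    simp only [gapMap] at h
    omega
  · intro h
    have hsub : (Finset.univ.filter fun l : Fin (p.len + 1) => (l : ℕ) < i + 1) ⊆
        Finset.univ.filter fun l : Fin (p.len + 1) => (θ.toOrderHom l : ℕ) < j := by
      intro l hl
      simp only [Finset.mem_filter, Finset.mem_univ, true_and] at hl ⊢
      have : θ.toOrderHom l ≤ θ.toOrderHom i := θ.toOrderHom.monotone (by omega)
      exact lt_of_le_of_lt this h
    have := Finset.card_le_card hsub
    rw [Fin.card_filter_val_lt] at this
    have hi := i.isLt
    simp only [gapMap]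
    omega

/-- Characterization of `gapMap`. -/
theorem gapMap_eq {p q : SimplexCategory} (θ : p ⟶ q) (j : Fin (q.len + 2)) (g : Fin (p.len + 2))
    (h : ∀ i : Fin (p.len + 1), (i : ℕ) < g ↔ (θ.toOrderHom i : ℕ) < j) : gapMap θ j = g := by
  have h' : ∀ i : Fin (p.len + 1), (i : ℕ) < gapMap θ j ↔ (i : ℕ) < g := fun i =>
    (lt_gapMap_iff θ j i).trans (h i).symm
  ext
  have h1 := (gapMap θ j).isLt
  have h2 := g.isLt
  rcases lt_trichotomy (gapMap θ j : ℕ) g with hlt | heq | hlt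
  · have := (h' ⟨gapMap θ j, by omega⟩).2 hlt
    simp at this
  · exact heq
  · have := (h' ⟨g, by omega⟩).1 hlt
    simp at this

theorem gapMap_id (p : SimplexCategory) (j : Fin (p.len + 2)) : gapMap (𝟙 p) j = j :=
  gapMap_eq _ _ _ fun _ => Iff.rfl

theorem gapMap_comp {p q r : SimplexCategory} (θ : p ⟶ q) (ψ : q ⟶ r) (j : Fin (r.len + 2)) :
    gapMap (θ ≫ ψ) j = gapMap θ (gapMap ψ j) :=
  gapMap_eq _ _ _ fun i => (lt_gapMap_iff θ _ i).trans (lt_gapMap_iff ψ j _)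

theorem withEnds_act {Y : Type} (a b : Y) {p q : SimplexCategory} (θ : p ⟶ q)
    (x : Fin p.len → Y) (j : Fin (q.len + 2)) :
    withEnds a b (act a b θ x) j = withEnds a b x (gapMap θ j) := by
  rcases end_cases j with rfl | rfl | ⟨k, rfl⟩
  · rw [gapMap_zero, withEnds_zero, withEnds_zero]
  · rw [gapMap_last, withEnds_last, withEnds_last]
  · rw [withEnds_mid, act]

theorem act_id {Y : Type} (a b : Y) (p : SimplexCategory) (x : Fin p.len → Y) :
    act a b (𝟙 p) x = x := by
  funext k
  rw [act, gapMap_id, withEnds_mid]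

theorem act_comp {Y : Type} (a b : Y) {p q r : SimplexCategory} (θ : p ⟶ q) (ψ : q ⟶ r)
    (x : Fin p.len → Y) : act a b (θ ≫ ψ) x = act a b ψ (act a b θ x) := by
  funext k
  rw [act, act, gapMap_comp, withEnds_act]

theorem continuous_withEnds {Y : Type} [TopologicalSpace Y] (a b : Y) {p : ℕ} (j : Fin (p + 2)) :
    Continuous fun x : Fin p → Y => withEnds a b x j := by
  rcases end_cases j with rfl | rfl | ⟨k, rfl⟩
  · simpa only [withEnds_zero] using continuous_const
  · simpa only [withEnds_last] using continuous_const
  · simpa only [withEnds_mid] using continuous_apply k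

theorem continuous_act {Y : Type} [TopologicalSpace Y] (a b : Y) {p q : SimplexCategory}
    (θ : p ⟶ q) : Continuous (act a b θ : (Fin p.len → Y) → (Fin q.len → Y)) :=
  continuous_pi fun _ => continuous_withEnds a b _

/-- `d^0 (x₁, …, x_p) = (a, x₁, …, x_p)`. -/
theorem act_δ_zero {Y : Type} (a b : Y) (p : ℕ) (x : Fin p → Y) :
    act a b (SimplexCategory.δ (n := p) 0) x = (Fin.cons a x : Fin (p + 1) → Y) := by
  funext k
  rw [act, gapMap_eq _ _ k.castSucc]
  · rcases Fin.eq_zero_or_eq_succ k with rfl | ⟨l, rfl⟩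
    · rfl
    · rw [Fin.cons_succ]
      exact withEnds_mid a b x l
  · intro i
    simp [SimplexCategory.δ]

/-- `d^i (x₁, …, x_p) = (x₁, …, x_i, x_i, …, x_p)` for `1 ≤ i ≤ p`. -/
theorem act_δ_mid {Y : Type} (a b : Y) (p : ℕ) (x : Fin p → Y) (i : Fin p) :
    act a b (SimplexCategory.δ (n := p) i.succ.castSucc) x =
      fun k : Fin (p + 1) => x (i.predAbove k) := by
  funext k
  rw [act, gapMap_eq _ _ (i.predAbove k).succ.castSucc, withEnds_mid]
  intro l
  simp [SimplexCategory.δ, Fin.succAbove, Fin.predAbove, Fin.lt_def]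
  split_ifs <;> simp <;> omega

/-- `d^{p+1} (x₁, …, x_p) = (x₁, …, x_p, b)`. -/
theorem act_δ_last {Y : Type} (a b : Y) (p : ℕ) (x : Fin p → Y) :
    act a b (SimplexCategory.δ (n := p) (Fin.last (p + 1))) x =
      (Fin.snoc (α := fun _ => Y) x b : Fin (p + 1) → Y) := by
  funext k
  rw [act, gapMap_eq _ _ k.succ]
  · rfl
  · intro i
    simp [SimplexCategory.δ]

/-- `s^i (x₁, …, x_{p+1}) = (x₁, …, x_i, x_{i+2}, …, x_{p+1})` for `0 ≤ i ≤ p`. -/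
theorem act_σ {Y : Type} (a b : Y) (p : ℕ) (x : Fin (p + 1) → Y) (i : Fin (p + 1)) :
    act a b (SimplexCategory.σ (n := p) i) x = fun k : Fin p => x (i.succAbove k) := by
  funext k
  rw [act, gapMap_eq _ _ (i.succAbove k).succ.castSucc]
  · exact withEnds_mid a b x _
  · intro l
    simp [SimplexCategory.σ, Fin.succAbove, Fin.predAbove, Fin.lt_def]
    split_ifs <;> simp <;> omega

/-! ### Cosimplicial spaces -/

/-- The geometric cobar construction on the space `X` with base point `x₀`: the cosimplicial space
with `p`-th space `X^p`, whose first and last cofaces insert the base point, whose other cofaces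
double an entry, and whose codegeneracies forget an entry. -/
def cobar (X : Type) [TopologicalSpace X] (x₀ : X) : CosimplicialObject TopCat.{0} where
  obj p := TopCat.of (Fin p.len → X)
  map θ := TopCat.ofHom ⟨act x₀ x₀ θ, continuous_act x₀ x₀ θ⟩
  map_id p := by
    refine TopCat.hom_ext (ContinuousMap.ext fun x => ?_)
    exact act_id x₀ x₀ p x
  map_comp θ ψ := by
    refine TopCat.hom_ext (ContinuousMap.ext fun x => ?_)
    exact act_comp x₀ x₀ θ ψ x

/-- The diagonal `p ↦ X^{(p, …, p)}` of an `m`-cosimplicial space, with structure maps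
`(θ, …, θ)`. -/
def diagonal {m : ℕ} (X : (Fin m → SimplexCategory) ⥤ TopCat.{0}) : CosimplicialObject TopCat.{0} :=
  Functor.pi' (fun _ => 𝟭 SimplexCategory) ⋙ X

/-- A levelwise subspace of a cosimplicial space that is stable under the structure maps. -/
def subCosimplicial (X : CosimplicialObject TopCat.{0}) (S : ∀ p, Set (X.obj p))
    (hS : ∀ ⦃p q : SimplexCategory⦄ (θ : p ⟶ q), Set.MapsTo (X.map θ).hom (S p) (S q)) :
    CosimplicialObject TopCat.{0} where
  obj p := TopCat.of (S p)
  map θ := TopCat.ofHom ⟨(hS θ).restrict, (X.map θ).hom.continuous.restrict (hS θ)⟩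
  map_id p := by
    refine TopCat.hom_ext (ContinuousMap.ext fun x => Subtype.ext ?_)
    exact ConcreteCategory.congr_hom (X.map_id p) x.1
  map_comp θ ψ := by
    refine TopCat.hom_ext (ContinuousMap.ext fun x => Subtype.ext ?_)
    exact ConcreteCategory.congr_hom (X.map_comp θ ψ) x.1

/-- The `m`-cosimplicial space of retracted punctured strands in `Y`: its value on `([p_1], …, [p_m])`
consists of `p_i` points `x i 1, …, x i p_i` in `Y` on the `i`-th strand, whose fixed first and last
points are `a i` and `b i`. The maps in the `i`-th direction double (or insert `a i` and `b i`) and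
forget points of the `i`-th strand. -/
def strands (m : ℕ) (Y : Type) [TopologicalSpace Y] (a b : Fin m → Y) :
    (Fin m → SimplexCategory) ⥤ TopCat.{0} where
  obj p := TopCat.of (∀ i, Fin (p i).len → Y)
  map θ := TopCat.ofHom ⟨fun x i => act (a i) (b i) (θ i) (x i),
    continuous_pi fun i => (continuous_act _ _ _).comp (continuous_apply i)⟩
  map_id p := by
    refine TopCat.hom_ext (ContinuousMap.ext fun x => funext fun i => ?_)
    exact act_id _ _ _ _
  map_comp θ ψ := by
    refine TopCat.hom_ext (ContinuousMap.ext fun x => funext fun i => ?_)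
    exact act_comp _ _ _ _ _

/-! ### The two models for braids -/

/-- In each column, the points of the different strands are distinct. -/
def IsColumnwiseConf {m p : ℕ} {Y : Type} (x : Fin m → Fin p → Y) : Prop :=
  ∀ j, Function.Injective fun i => x i j

/-- In each column, the points of the different strands have the same height. -/
def IsLevel {k m p : ℕ} (x : Fin m → Fin p → Cube k × unitInterval) : Prop :=
  ∀ i i' j, (x i j).2 = (x i' j).2

/-- Along each strand, the heights increase (weakly). -/
def IsRising {k m p : ℕ} (x : Fin m → Fin p → Cube k × unitInterval) : Prop :=
  ∀ i, Monotone fun j => (x i j).2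

theorem IsColumnwiseConf.act {m : ℕ} {Y : Type} {a b : Fin m → Y} (ha : Function.Injective a)
    (hb : Function.Injective b) {p q : SimplexCategory} (θ : p ⟶ q)
    {x : Fin m → Fin p.len → Y} (hx : IsColumnwiseConf x) :
    IsColumnwiseConf fun i => act (a i) (b i) θ (x i) := by
  intro j
  simp only [_root_.act]
  rcases end_cases (gapMap θ j.succ.castSucc) with h | h | ⟨l, h⟩ <;> rw [h]
  · simpa only [withEnds_zero] using ha
  · simpa only [withEnds_last] using hb
  · simpa only [withEnds_mid] using hx l

/-- The cosimplicial model `BR^•_m(I, I^{k+1})` for braids as a functor of a single variable, with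
strands based at the configuration `y`: its `p`-th space consists of `p` configurations of `m`
points in `I^k` (the points `x i 1, …, x i p` lie on the `i`-th strand, and the `j`-th configuration
is `x · j`). As `I^k × {0}` and `I^k × {1}` are identified, the first and the last point of the
`i`-th strand are both `y i`. -/
def braidModel {k m : ℕ} (y : Conf m (Cube k)) : CosimplicialObject TopCat.{0} :=
  subCosimplicial (diagonal (strands m (Cube k) y.1 y.1))
    (fun p => {x | IsColumnwiseConf (Y := Cube k) (p := p.len) x})
    (fun _ _ θ _ hx => IsColumnwiseConf.act y.2 y.2 θ hx)

/-- The first point `(y i, 0) ∈ I^k × {0}` of the `i`-th strand in `I^{k+1} = I^k × I`. -/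
def bottomPt {k m : ℕ} (y : Conf m (Cube k)) (i : Fin m) : Cube k × unitInterval := (y.1 i, 0)

/-- The last point `(y i, 1) ∈ I^k × {1}` of the `i`-th strand in `I^{k+1} = I^k × I`. -/
def topPt {k m : ℕ} (y : Conf m (Cube k)) (i : Fin m) : Cube k × unitInterval := (y.1 i, 1)

theorem withEnds_height_mono {k p : ℕ} (u v : Cube k) (x : Fin p → Cube k × unitInterval)
    (hx : Monotone fun j => (x j).2) :
    Monotone fun j => (withEnds (u, 0) (v, 1) x j).2 := by
  intro j j' h
  rcases end_cases j with rfl | rfl | ⟨l, rfl⟩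
  · simp only [withEnds_zero]
    exact unitInterval.nonneg'
  · obtain rfl : j' = Fin.last (p + 1) := le_antisymm (Fin.le_last _) h
    exact le_rfl
  · rcases end_cases j' with rfl | rfl | ⟨l', rfl⟩
    · simp at h
    · simp only [withEnds_last]
      exact unitInterval.le_one'
    · simp only [withEnds_mid]
      exact hx (Fin.le_def.2 (by have := Fin.le_def.1 h; simpa using this))

theorem IsLevel.act {k m : ℕ} (y : Conf m (Cube k)) {p q : SimplexCategory} (θ : p ⟶ q)
    {x : Fin m → Fin p.len → Cube k × unitInterval} (hx : IsLevel x) :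
    IsLevel fun i => act (bottomPt y i) (topPt y i) θ (x i) := by
  intro i i' j
  simp only [_root_.act]
  rcases end_cases (gapMap θ j.succ.castSucc) with h | h | ⟨l, h⟩ <;> rw [h]
  · rfl
  · rw [withEnds_last, withEnds_last]
    rfl
  · rw [withEnds_mid, withEnds_mid]
    exact hx i i' l

theorem IsRising.act {k m : ℕ} (y : Conf m (Cube k)) {p q : SimplexCategory} (θ : p ⟶ q)
    {x : Fin m → Fin p.len → Cube k × unitInterval} (hx : IsRising x) :
    IsRising fun i => act (bottomPt y i) (topPt y i) θ (x i) := fun i _ _ h =>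
  withEnds_height_mono _ _ _ (hx i)
    (gapMap_mono θ (Fin.castSucc_le_castSucc_iff.2 (Fin.succ_le_succ_iff.2 h)))

/-- The diagonal model for braids in `I^{k+1} = I^k × I`, obtained by puncturing all `m` strands at
the same times and retracting the resulting level arcs to points. It is the subspace of the diagonal
of the `m`-cosimplicial space of strands (from `(y i, 0)` to `(y i, 1)`) that is cut out by the
conditions on a braid: the `m` points of each column are distinct points of one and the same slice
`I^k × {t}`, and the slices rise along the strands. The cofaces and codegeneracies double, insert
and forget `m` points at the same time. -/
def diagonalBraidModel {k m : ℕ} (y : Conf m (Cube k)) : CosimplicialObject TopCat.{0} :=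
  subCosimplicial (diagonal (strands m (Cube k × unitInterval) (bottomPt y) (topPt y)))
    (fun p => {x | IsColumnwiseConf (Y := Cube k × unitInterval) (p := p.len) x ∧
      IsLevel (p := p.len) x ∧ IsRising (p := p.len) x})
    (fun _ _ θ _ hx =>
      ⟨hx.1.act (fun _ _ h => y.2 (congrArg Prod.fst h)) (fun _ _ h => y.2 (congrArg Prod.fst h)) θ,
        hx.2.1.act y θ, hx.2.2.act y θ⟩)

/-! ### Totalization and homotopy limit -/

/-- The space of cosimplicial maps `K → X`, with the subspace topology from the product of the
mapping spaces (with the compact-open topology). -/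
def MapSpace (K X : CosimplicialObject TopCat.{0}) : Type :=
  {f : ∀ p, C(K.obj p, X.obj p) //
    ∀ ⦃p q : SimplexCategory⦄ (θ : p ⟶ q), (X.map θ).hom.comp (f p) = (f q).comp (K.map θ).hom}

instance (K X : CosimplicialObject TopCat.{0}) : TopologicalSpace (MapSpace K X) :=
  instTopologicalSpaceSubtype

/-- The totalization of `X`: the space of cosimplicial maps from the cosimplicial standard simplex
`Δ^•` to `X`. -/
abbrev Tot (X : CosimplicialObject TopCat.{0}) : Type :=
  MapSpace SimplexCategory.toTop₀ X

/-- The cosimplicial space `[p] ↦ |N(Δ ↓ [p])|`, the geometric realization of the nerve of the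
category of objects over `[p]` in the simplex category. -/
def overNerve : CosimplicialObject TopCat.{0} :=
  Over.mapFunctor SimplexCategory ⋙ nerveFunctor ⋙ SSet.toTop

/-- The (Bousfield-Kan) homotopy limit of the cosimplicial space `X`. -/
abbrev HoLim (X : CosimplicialObject TopCat.{0}) : Type := MapSpace overNerve X

/-- The map of cosimplicial spaces `φ` is a homotopy equivalence at each level. -/
def IsLevelwiseHomotopyEquiv {X Y : CosimplicialObject TopCat.{0}} (φ : X ⟶ Y) : Prop :=
  ∀ p, ∃ e : ContinuousMap.HomotopyEquiv (X.obj p) (Y.obj p), e.toFun = (φ.app p).hom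

end

/-! A point of `X^p` is a family of points of `X` indexed by the non-constant monotone maps `[p] →
[1]`, the cuts of `[p]`. Hence a cosimplicial map from any `K` to the cobar construction on `(X,
x₀)` is the same as a map `K^1 → X` that sends the images of both cofaces `K^0 → K^1` to `x₀`; this
is a homeomorphism of mapping spaces when `X` is a uniform space (`mapSpaceCobarHomeo`).

For `K = Δ^•` these are the maps of an interval with both ends at `x₀`, so `Tot` of the cobar
construction is the loop space itself. For the homotopy limit, `K^1 = |N(Δ ↓ [1])|` and the two
images are copies of `|N(Δ ↓ [0])|`; this pair is compared with the interval and its vertices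
(`nonempty_homotopyEquiv_relMap`). One map places the objects that are constant at `0` or `1` at the
vertices and all others at the midpoint. The map back runs along the two edges that join the
vertices `[0] → [1]` to the terminal object. One composite is the identity. The other is homotopic
to the identity through maps of pairs: slide the non-constant objects to the terminal object, then
contract the constant objects at each end. Both homotopies are affine on the simplices of chains and
glue.

Reading a braid column by column identifies the braid model with the cobar construction
(`braidModelIso`). In the diagonal model the extra data are the heights, which form a convex set.
For `m > 0` forgetting them has no cosimplicial section, since the two cofaces out of level `0`
insert the different heights `0` and `1`. A point of `Δ^p` does supply heights naturally, by partial
sums of its barycentric coordinates, and a straight-line homotopy moves given heights to these. A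
cosimplicial map `K → Δ^•` therefore makes the forgetful map a homotopy equivalence on maps out of
`K` (`nonempty_mapSpace_diagonal`); it is the identity for `Tot` and the last vertex map for the
homotopy limit (`nonempty_overNerve_hom`). -/

noncomputable section

/-! ### Maps out of the realization of a simplicial set -/

/-- The characteristic map `Δ^n → |S|` of an `n`-simplex `x` of `S`. -/
def simplexMap {S : SSet.{0}} {n : SimplexCategory} (x : S.obj (Opposite.op n)) :
    C(stdSimplex ℝ (Fin (n.len + 1)), SSet.toTop.obj S) :=
  TopCat.toSSetObjEquiv _ _ ((sSetTopAdj.unit.app S).app _ x)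

theorem toSSetObjEquiv_app {Z W : TopCat.{0}} (f : Z ⟶ W) {n : SimplexCategory}
    (x : (TopCat.toSSet.obj Z).obj (Opposite.op n)) (s : stdSimplex ℝ (Fin (n.len + 1))) :
    TopCat.toSSetObjEquiv _ _ ((TopCat.toSSet.map f).app _ x) s =
      f.hom (TopCat.toSSetObjEquiv _ _ x s) := rfl

theorem simplexMap_map {S : SSet.{0}} {n k : SimplexCategory} (θ : k ⟶ n)
    (x : S.obj (Opposite.op n)) (s : stdSimplex ℝ (Fin (k.len + 1))) :
    simplexMap (S.map θ.op x) s = simplexMap x (stdSimplex.map θ.toOrderHom s) := by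
  have h := NatTrans.naturality_apply (sSetTopAdj.unit.app S) θ.op x
  exact congr_arg (fun z => TopCat.toSSetObjEquiv _ _ z s) h

theorem toTop_map_simplexMap {S T : SSet.{0}} (f : S ⟶ T) {n : SimplexCategory}
    (x : S.obj (Opposite.op n)) (s : stdSimplex ℝ (Fin (n.len + 1))) :
    (SSet.toTop.map f).hom (simplexMap x s) = simplexMap (f.app _ x) s := by
  have h := congr_arg (fun g : S ⟶ TopCat.toSSet.obj (SSet.toTop.obj T) => g.app _ x)
    (sSetTopAdj.unit.naturality f)
  simp only [simplexMap]
  rw [← toSSetObjEquiv_app]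
  exact (congr_arg (fun z => TopCat.toSSetObjEquiv _ _ z s) h).symm

/-- A compatible family of maps from standard simplices glues to a map on the realization. -/
theorem exists_realization_desc {S : SSet.{0}} {Z : Type} [TopologicalSpace Z]
    (φ : ∀ n : SimplexCategory, S.obj (Opposite.op n) → C(stdSimplex ℝ (Fin (n.len + 1)), Z))
    (hφ : ∀ ⦃k n : SimplexCategory⦄ (θ : k ⟶ n) (x : S.obj (Opposite.op n))
      (s : stdSimplex ℝ (Fin (k.len + 1))),
        φ k (S.map θ.op x) s = φ n x (stdSimplex.map θ.toOrderHom s)) :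
    ∃ F : C(SSet.toTop.obj S, Z), ∀ n (x : S.obj (Opposite.op n)) s,
      F (simplexMap x s) = φ n x s := by
  let Φ : S ⟶ TopCat.toSSet.obj (TopCat.of Z) :=
    { app := fun n => TypeCat.ofHom
        (fun x => (TopCat.toSSetObjEquiv (TopCat.of Z) n).symm (φ n.unop x))
      naturality := by
        intro n k θ
        ext x
        apply (TopCat.toSSetObjEquiv (TopCat.of Z) k).injective
        ext s
        exact hφ θ.unop x s }
  let F := (sSetTopAdj.homEquiv S (TopCat.of Z)).symm Φ
  refine ⟨F.hom, fun n x s => ?_⟩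
  have h : sSetTopAdj.unit.app S ≫ TopCat.toSSet.map F = Φ :=
    (Adjunction.homEquiv_unit sSetTopAdj S (TopCat.of Z) F).symm.trans
      (Equiv.apply_symm_apply _ _)
  exact congr_arg (fun g : S ⟶ TopCat.toSSet.obj (TopCat.of Z) =>
    TopCat.toSSetObjEquiv _ _ (g.app (Opposite.op n) x) s) h

theorem realization_hom_ext {S : SSet.{0}} {Z : TopCat.{0}} (f g : SSet.toTop.obj S ⟶ Z)
    (h : ∀ n (x : S.obj (Opposite.op n)) s, f.hom (simplexMap x s) = g.hom (simplexMap x s)) :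
    f = g := by
  apply (sSetTopAdj.homEquiv S Z).injective
  refine (Adjunction.homEquiv_unit sSetTopAdj S Z f).trans
    (Eq.trans ?_ (Adjunction.homEquiv_unit sSetTopAdj S Z g).symm)
  ext n x
  apply (TopCat.toSSetObjEquiv Z n).injective
  ext s
  exact h n.unop x s

/-- Maps out of the realization are determined on simplices. For the indiscrete topology on `Prop`
every predicate is such a map, so one that holds on all simplices holds everywhere; here the
predicate is membership in the image of a characteristic map. -/
theorem exists_simplexMap_eq {S : SSet.{0}} (w : SSet.toTop.obj S) :
    ∃ n : SimplexCategory, ∃ x : S.obj (Opposite.op n), ∃ s, simplexMap x s = w := by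
  let : TopologicalSpace Prop := ⊤
  let f : SSet.toTop.obj S ⟶ TopCat.of Prop := TopCat.ofHom ⟨fun _ => True, continuous_top⟩
  let g : SSet.toTop.obj S ⟶ TopCat.of Prop := TopCat.ofHom
    ⟨fun w => ∃ n : SimplexCategory, ∃ x : S.obj (Opposite.op n), ∃ s, simplexMap x s = w,
      continuous_top⟩
  have h : f = g := realization_hom_ext f g fun n x s => by
    simp only [f, g, TopCat.hom_ofHom, ContinuousMap.coe_mk, eq_iff_iff, true_iff]
    exact ⟨n, x, s, rfl⟩
  have h2 := ConcreteCategory.congr_hom h w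
  exact of_eq_true h2.symm

/-! ### Barycentric coordinates -/

section Barycentric

variable {L L' L'' : Type} [Fintype L] [Fintype L'] [Fintype L'']

theorem stdSimplex_map_apply [DecidableEq L'] (f : L → L') (s : stdSimplex ℝ L) (j : L') :
    stdSimplex.map f s j = ∑ i with f i = j, s i := by
  rw [stdSimplex.map_coe, FunOnFinite.linearMap_apply_apply]

/-- The affine extension to the simplex of a map defined on its vertices. -/
def affineExtend (M : L → stdSimplex ℝ L') (s : stdSimplex ℝ L) : stdSimplex ℝ L' :=
  ⟨fun j => ∑ i, s i * M i j,
    fun j => Finset.sum_nonneg fun i _ => mul_nonneg (s.2.1 i) ((M i).2.1 j), by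
      rw [Finset.sum_comm]
      simp_rw [← Finset.mul_sum, stdSimplex.sum_eq_one, mul_one]
      exact s.2.2⟩

theorem affineExtend_apply (M : L → stdSimplex ℝ L') (s : stdSimplex ℝ L) (j : L') :
    affineExtend M s j = ∑ i, s i * M i j := rfl

theorem affineExtend_map (M : L' → stdSimplex ℝ L'') (θ : L → L') (s : stdSimplex ℝ L) :
    affineExtend M (stdSimplex.map θ s) = affineExtend (M ∘ θ) s := by
  classical
  ext j
  simp only [affineExtend_apply, stdSimplex_map_apply, Finset.sum_mul, Function.comp]
  rw [← Finset.sum_fiberwise Finset.univ θ]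
  refine Finset.sum_congr rfl fun i _ => Finset.sum_congr rfl fun l hl => ?_
  rw [(Finset.mem_filter.1 hl).2]

theorem map_affineExtend (M : L → stdSimplex ℝ L') (θ : L' → L'') (s : stdSimplex ℝ L) :
    stdSimplex.map θ (affineExtend M s) = affineExtend (fun i => stdSimplex.map θ (M i)) s := by
  classical
  ext j
  simp only [affineExtend_apply, stdSimplex_map_apply, Finset.mul_sum]
  rw [Finset.sum_comm]

/-- Identifies the motions below as simplicial maps at times when every vertex sits at a vertex, so
that `chainMap_precomp` applies to them. -/
theorem affineExtend_vertex [DecidableEq L'] (θ : L → L') (s : stdSimplex ℝ L) :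
    affineExtend (fun i => stdSimplex.vertex (θ i)) s = stdSimplex.map θ s := by
  ext j
  simp only [affineExtend_apply, stdSimplex_map_apply, stdSimplex.vertex_coe, Pi.single_apply,
    Finset.sum_filter, mul_ite, mul_one, mul_zero]
  exact Finset.sum_congr rfl fun i _ => by simp only [eq_comm]

theorem affineExtend_const (p : stdSimplex ℝ L') (s : stdSimplex ℝ L) :
    affineExtend (fun _ => p) s = p := by
  ext j
  simp only [affineExtend_apply, ← Finset.sum_mul]
  rw [stdSimplex.sum_eq_one, one_mul]

theorem continuous_stdSimplex_apply (i : L) : Continuous fun s : stdSimplex ℝ L => s i :=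
  (continuous_apply i).comp continuous_subtype_val

theorem continuous_affineExtend {T : Type} [TopologicalSpace T] {M : T → L → stdSimplex ℝ L'}
    (hM : ∀ i, Continuous fun t => M t i) :
    Continuous fun p : stdSimplex ℝ L × T => affineExtend (M p.2) p.1 := by
  refine Continuous.subtype_mk (continuous_pi fun j => continuous_finsetSum _ fun i _ => ?_) _
  exact ((continuous_stdSimplex_apply i).comp continuous_fst).mul
    ((continuous_stdSimplex_apply j).comp ((hM i).comp continuous_snd))

/-- The point of a simplex dividing the segment from `p` to `q` at time `t`. -/
def segmentPt (p q : stdSimplex ℝ L) (t : unitInterval) : stdSimplex ℝ L :=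
  ⟨fun j => (1 - t) * p j + t * q j,
    fun j => add_nonneg (mul_nonneg (sub_nonneg.2 t.2.2) (p.2.1 j)) (mul_nonneg t.2.1 (q.2.1 j)), by
      rw [Finset.sum_add_distrib, ← Finset.mul_sum, ← Finset.mul_sum, stdSimplex.sum_eq_one,
        stdSimplex.sum_eq_one]
      ring⟩

theorem segmentPt_apply (p q : stdSimplex ℝ L) (t : unitInterval) (j : L) :
    segmentPt p q t j = (1 - t) * p j + t * q j := rfl

theorem segmentPt_zero (p q : stdSimplex ℝ L) : segmentPt p q 0 = p := by
  ext j; simp [segmentPt_apply]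

theorem segmentPt_one (p q : stdSimplex ℝ L) : segmentPt p q 1 = q := by
  ext j; simp [segmentPt_apply]

theorem continuous_segmentPt (p q : stdSimplex ℝ L) : Continuous (segmentPt p q) := by
  refine Continuous.subtype_mk (continuous_pi fun j => ?_) _
  fun_prop

theorem map_segmentPt (θ : L → L') (p q : stdSimplex ℝ L) (t : unitInterval) :
    stdSimplex.map θ (segmentPt p q t) =
      segmentPt (stdSimplex.map θ p) (stdSimplex.map θ q) t := by
  classical
  ext j
  simp only [segmentPt_apply, stdSimplex_map_apply, Finset.sum_add_distrib, Finset.mul_sum]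

end Barycentric

/-! ### Points of the realization of a nerve -/

section Nerve

variable {C D : Type} [SmallCategory C] [SmallCategory D]
variable {L L' : Type} [Fintype L] [LinearOrder L] [Nonempty L]
  [Fintype L'] [LinearOrder L'] [Nonempty L']

theorem card_eq_pred_add_one (L : Type) [Fintype L] [Nonempty L] :
    Fintype.card L = (Fintype.card L - 1) + 1 :=
  (Nat.succ_pred_eq_of_pos Fintype.card_pos).symm

/-- The increasing enumeration of a nonempty finite linear order. -/
def enumIso (L : Type) [Fintype L] [LinearOrder L] [Nonempty L] :
    Fin ((SimplexCategory.mk (Fintype.card L - 1)).len + 1) ≃o L :=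
  Fintype.orderIsoFinOfCardEq L (card_eq_pred_add_one L)

/-- The map from the simplex with vertices `L` to the realization of the nerve of `C` that is
given by a chain `c : L ⥤ C`. -/
def chainMap (c : L ⥤ C) : C(stdSimplex ℝ L, SSet.toTop.obj (nerve C)) :=
  (simplexMap (S := nerve C) (n := SimplexCategory.mk (Fintype.card L - 1))
    ((enumIso L).monotone.functor ⋙ c)).comp ⟨_, stdSimplex.continuous_map (enumIso L).symm⟩

theorem simplexMap_precomp {n k : SimplexCategory} (θ : Fin (k.len + 1) →o Fin (n.len + 1))
    (c : Fin (n.len + 1) ⥤ C) (s : stdSimplex ℝ (Fin (k.len + 1))) :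
    simplexMap (S := nerve C) (n := k) (θ.monotone.functor ⋙ c) s =
      simplexMap (S := nerve C) (n := n) c (stdSimplex.map θ s) :=
  simplexMap_map (S := nerve C) (SimplexCategory.Hom.mk θ) c s

/-- Conjugating `θ` by the enumerations gives a morphism of the simplex category. Arbitrary finite
orders `L` are allowed so that `WithTop L` can index a chain without renumbering. -/
theorem chainMap_precomp (θ : L →o L') (c : L' ⥤ C) (s : stdSimplex ℝ L) :
    chainMap (θ.monotone.functor ⋙ c) s = chainMap c (stdSimplex.map θ s) := by
  let θ' : Fin ((SimplexCategory.mk (Fintype.card L - 1)).len + 1) →o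
      Fin ((SimplexCategory.mk (Fintype.card L' - 1)).len + 1) :=
    ((enumIso L').symm : L' →o _).comp (θ.comp (enumIso L : _ →o L))
  have h : (enumIso L).monotone.functor ⋙ θ.monotone.functor ⋙ c =
      θ'.monotone.functor ⋙ (enumIso L').monotone.functor ⋙ c := by
    have : (enumIso L).monotone.functor ⋙ θ.monotone.functor =
        θ'.monotone.functor ⋙ (enumIso L').monotone.functor :=
      CategoryTheory.Functor.ext (fun i => by
        change θ (enumIso L i) = enumIso L' ((enumIso L').symm (θ (enumIso L i)))
        rw [OrderIso.apply_symm_apply]) (fun _ _ _ => Subsingleton.elim _ _)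
    rw [← Functor.assoc, this, Functor.assoc]
  simp only [chainMap, ContinuousMap.comp_apply, ContinuousMap.coe_mk]
  rw [h, simplexMap_precomp, stdSimplex.map_comp_apply, stdSimplex.map_comp_apply]
  congr 2
  ext i
  simp [θ']

theorem simplexMap_eq_chainMap {n : SimplexCategory} (c : Fin (n.len + 1) ⥤ C)
    (s : stdSimplex ℝ (Fin (n.len + 1))) :
    simplexMap (S := nerve C) (n := n) c s = chainMap c s := by
  simp only [chainMap, ContinuousMap.comp_apply, ContinuousMap.coe_mk]
  have := simplexMap_precomp (n := n) (k := SimplexCategory.mk (Fintype.card (Fin (n.len + 1)) - 1))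
    (enumIso (Fin (n.len + 1)) : _ →o Fin (n.len + 1)) c
    (stdSimplex.map (enumIso (Fin (n.len + 1))).symm s)
  refine Eq.trans ?_ this.symm
  rw [stdSimplex.map_comp_apply]
  congr 1
  conv_lhs => rw [← stdSimplex.map_id_apply s]
  congr 1
  ext i : 1
  exact ((enumIso (Fin (n.len + 1))).apply_symm_apply i).symm

theorem toTop_map_chainMap (F : C ⥤ D) (c : L ⥤ C) (s : stdSimplex ℝ L) :
    (SSet.toTop.map (nerveMap F)).hom (chainMap c s) = chainMap (c ⋙ F) s :=
  toTop_map_simplexMap (nerveMap F) _ _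

/-- A natural family of maps on the chains of `C` glues to a map on the realization of the nerve. -/
theorem exists_nerve_desc {Z : Type} [TopologicalSpace Z]
    (φ : ∀ (L : Type) [Fintype L] [LinearOrder L] [Nonempty L], (L ⥤ C) → C(stdSimplex ℝ L, Z))
    (hφ : ∀ (L L' : Type) [Fintype L] [LinearOrder L] [Nonempty L] [Fintype L'] [LinearOrder L']
      [Nonempty L'] (θ : L →o L') (x : L' ⥤ C) (s : stdSimplex ℝ L),
        φ L (θ.monotone.functor ⋙ x) s = φ L' x (stdSimplex.map θ s)) :
    ∃ F : C(SSet.toTop.obj (nerve C), Z), ∀ (L : Type) [Fintype L] [LinearOrder L] [Nonempty L]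
      (x : L ⥤ C) (s : stdSimplex ℝ L), F (chainMap x s) = φ L x s := by
  obtain ⟨F, hF⟩ := exists_realization_desc (S := nerve C)
    (fun n x => φ (Fin (n.len + 1)) x) (fun k n θ x s => hφ _ _ θ.toOrderHom x s)
  refine ⟨F, fun L _ _ _ x s => ?_⟩
  refine (hF _ _ _).trans ?_
  -- Naturality along the enumeration of `L` reduces to the standard orders.
  have := hφ _ _ (enumIso L : _ →o L) x (stdSimplex.map (enumIso L).symm s)
  refine this.trans ?_
  rw [stdSimplex.map_comp_apply]
  conv_rhs => rw [← stdSimplex.map_id_apply s]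
  congr 2
  ext i : 1
  exact (enumIso L).apply_symm_apply i

/-- A natural family of homotopies on the chains of `C` glues to a homotopy on the realization. -/
theorem exists_nerve_homotopy {Z : Type} [TopologicalSpace Z]
    (φ : ∀ (L : Type) [Fintype L] [LinearOrder L] [Nonempty L], (L ⥤ C) →
      C(stdSimplex ℝ L × unitInterval, Z))
    (hφ : ∀ (L L' : Type) [Fintype L] [LinearOrder L] [Nonempty L] [Fintype L'] [LinearOrder L']
      [Nonempty L'] (θ : L →o L') (x : L' ⥤ C) (s : stdSimplex ℝ L) (t : unitInterval),
        φ L (θ.monotone.functor ⋙ x) (s, t) = φ L' x (stdSimplex.map θ s, t)) :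
    ∃ F : C(SSet.toTop.obj (nerve C) × unitInterval, Z), ∀ (L : Type) [Fintype L] [LinearOrder L]
      [Nonempty L] (x : L ⥤ C) (s : stdSimplex ℝ L) (t : unitInterval),
        F (chainMap x s, t) = φ L x (s, t) := by
  -- Glue maps into `C(unitInterval, Z)` and uncurry: this avoids any comparison of the realization
  -- of a product with the product of realizations.
  obtain ⟨F, hF⟩ := exists_nerve_desc (C := C) (fun L _ _ _ x => (φ L x).curry)
    (fun L L' _ _ _ _ _ _ θ x s => ContinuousMap.ext fun t => hφ L L' θ x s t)
  refine ⟨F.uncurry, fun L _ _ _ x s t => ?_⟩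
  exact congr_arg (fun f : C(unitInterval, Z) => f t) (hF L x s)

theorem exists_chainMap_eq (w : SSet.toTop.obj (nerve C)) :
    ∃ (n : ℕ) (x : Fin (n + 1) ⥤ C) (s : stdSimplex ℝ (Fin (n + 1))), chainMap x s = w := by
  obtain ⟨n, x, s, rfl⟩ := exists_simplexMap_eq w
  exact ⟨n.len, x, s, (simplexMap_eq_chainMap x s).symm⟩

/-- The vertex of the realization of the nerve given by an object. -/
def objPt (T : C) : SSet.toTop.obj (nerve C) :=
  chainMap ((Functor.const Unit).obj T) default

/-- A vertex is the restriction to a one-element chain, so it forgets everything but the object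
there. -/
theorem chainMap_vertex [DecidableEq L] (c : L ⥤ C) (i : L) :
    chainMap c (stdSimplex.vertex i) = objPt (c.obj i) := by
  have h := chainMap_precomp (⟨fun _ => i, fun _ _ _ => le_rfl⟩ : Unit →o L) c default
  have h2 : (default : stdSimplex ℝ Unit) = stdSimplex.vertex () := Subsingleton.elim _ _
  rw [h2, stdSimplex.map_vertex] at h
  refine h.symm.trans ?_
  rw [objPt, ← h2]
  congr 2
  exact CategoryTheory.Functor.hext (fun _ => rfl) (fun _ _ _ => heq_of_eq (c.map_id i))

end Nerve

/-! ### Chains extended by a terminal object -/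

section Extend

variable {C : Type} [SmallCategory C] {L L' : Type} [LinearOrder L] [LinearOrder L']

/-- The extension of a chain by a terminal object. -/
def extendTop (x : L ⥤ C) {T : C} (hT : Limits.IsTerminal T) : WithTop L ⥤ C where
  obj | ⊤ => T
      | (i : L) => x.obj i
  map {i j} h := match i, j, h with
      | _, ⊤, _ => hT.from _
      | (i : L), (j : L), h => x.map (homOfLE (WithTop.coe_le_coe.1 h.le))
      | ⊤, (j : L), h => (WithTop.not_top_le_coe _ h.le).elim
  map_id i := match i with
    | ⊤ => hT.hom_ext _ _
    | (i : L) => x.map_id i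
  map_comp {i j k} f g := match i, j, k, f, g with
    | _, _, ⊤, _, _ => hT.hom_ext _ _
    | _, ⊤, (k : L), _, g => (WithTop.not_top_le_coe _ g.le).elim
    | ⊤, (j : L), (k : L), f, _ => (WithTop.not_top_le_coe _ f.le).elim
    | (i : L), (j : L), (k : L), f, g => x.map_comp (homOfLE (WithTop.coe_le_coe.1 f.le))
        (homOfLE (WithTop.coe_le_coe.1 g.le))

/-- The monotone map of `WithTop`s induced by a monotone map. -/
def withTopHom (θ : L →o L') : WithTop L →o WithTop L' := ⟨WithTop.map θ, θ.monotone.withTop_map⟩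

theorem extendTop_precomp (θ : L →o L') (x : L' ⥤ C) {T : C} (hT : Limits.IsTerminal T) :
    (withTopHom θ).monotone.functor ⋙ extendTop x hT =
      extendTop (θ.monotone.functor ⋙ x) hT := by
  refine CategoryTheory.Functor.hext (fun i => ?_) (fun i j f => ?_)
  · cases i <;> rfl
  · match i, j, f with
    | ⊤, ⊤, _ => rfl
    | (i : L), ⊤, _ => rfl
    | (i : L), (j : L), _ => rfl
    | ⊤, (j : L), f => exact (WithTop.not_top_le_coe _ f.le).elim

/-- The inclusion of a linear order into its extension by a top element. -/
def coeTopHom (L : Type) [LinearOrder L] : L →o WithTop L := ⟨WithTop.some, WithTop.coe_mono⟩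

theorem coeTop_extendTop (x : L ⥤ C) {T : C} (hT : Limits.IsTerminal T) :
    (coeTopHom L).monotone.functor ⋙ extendTop x hT = x := rfl
end Extend

/-! ### The nerve of `Δ ↓ [1]` relative to the two copies of the nerve of `Δ ↓ [0]` -/

theorem hom_zero_eq_const {q : SimplexCategory} (θ : ⦋0⦌ ⟶ q) :
    θ = SimplexCategory.const ⦋0⦌ q (θ.toOrderHom 0) := by
  ext i
  obtain rfl : i = 0 := Subsingleton.elim (α := Fin 1) _ _
  rfl

/-- The object `e` of `Δ ↓ [1]` is constant at the vertex `τ`. -/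
def IsConstAt (τ : Fin 2) (e : Over (⦋1⦌ : SimplexCategory)) : Prop :=
  ∀ i, e.hom.toOrderHom i = τ

/-- The object `e` of `Δ ↓ [1]` is constant. -/
def IsConst (e : Over (⦋1⦌ : SimplexCategory)) : Prop := ∃ τ, IsConstAt τ e

theorem IsConstAt.unique {τ τ' : Fin 2} {e : Over (⦋1⦌ : SimplexCategory)} (h : IsConstAt τ e)
    (h' : IsConstAt τ' e) : τ = τ' := (h 0).symm.trans (h' 0)

theorem IsConstAt.of_hom {τ : Fin 2} {e e' : Over (⦋1⦌ : SimplexCategory)} (f : e ⟶ e')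
    (h : IsConstAt τ e') : IsConstAt τ e := fun i => by
  rw [← Over.w f]
  exact h _

/-- Constancy passes from the target of a morphism to its source, so the lower of the two objects is
constant at both values. A chain thus meets at most one of the two ends, which makes `constEnd`
meaningful. -/
theorem IsConstAt.of_chain {L : Type} [LinearOrder L] (x : L ⥤ Over (⦋1⦌ : SimplexCategory))
    {i j : L} {τ τ' : Fin 2} (hi : IsConstAt τ (x.obj i)) (hj : IsConstAt τ' (x.obj j)) :
    τ = τ' := by
  rcases le_total i j with h | h
  · exact hi.unique (hj.of_hom (x.map (homOfLE h)))
  · exact (hi.of_hom (x.map (homOfLE h))).unique hj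

/-- The functor `Δ ↓ [1] ⥤ Δ ↓ [0]` that forgets the structure map. -/
def overCollapse : Over (⦋1⦌ : SimplexCategory) ⥤ Over (⦋0⦌ : SimplexCategory) :=
  Over.map (SimplexCategory.isTerminalZero.from ⦋1⦌)

/-- The functor `Δ ↓ [0] ⥤ Δ ↓ [1]` induced by the vertex `τ`. -/
def overVertex (τ : Fin 2) : Over (⦋0⦌ : SimplexCategory) ⥤ Over (⦋1⦌ : SimplexCategory) :=
  Over.map (SimplexCategory.const ⦋0⦌ ⦋1⦌ τ)

theorem isConstAt_overVertex (τ : Fin 2) (e : Over (⦋0⦌ : SimplexCategory)) :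
    IsConstAt τ ((overVertex τ).obj e) := fun _ => rfl

/-- A chain of objects that are constant at `τ` comes from `Δ ↓ [0]`. -/
theorem comp_overCollapse_overVertex {L : Type} [Category L]
    (x : L ⥤ Over (⦋1⦌ : SimplexCategory)) {τ : Fin 2} (h : ∀ i, IsConstAt τ (x.obj i)) :
    x ⋙ overCollapse ⋙ overVertex τ = x := by
  have w : ∀ i, ((x ⋙ overCollapse ⋙ overVertex τ).obj i).hom = (x.obj i).hom := fun i => by
    ext j : 3
    exact (h i j).symm
  let e : x ⋙ overCollapse ⋙ overVertex τ ≅ x :=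
    NatIso.ofComponents (fun i => Over.isoMk (Iso.refl _)
      ((Category.id_comp _).trans (w i).symm)) (fun f => by
        ext : 1
        exact (Category.comp_id _).trans (Category.id_comp _).symm)
  have hobj : ∀ i, (x ⋙ overCollapse ⋙ overVertex τ).obj i = x.obj i := fun i =>
    congr_arg Over.mk (w i)
  -- An isomorphism is not enough, as chains are simplices of the nerve on the nose. The components
  -- of `e` are identities on underlying objects, hence the functors are equal.
  refine Functor.ext_of_iso e hobj fun i => ?_
  ext : 1
  rw [Over.eqToHom_left]
  rfl

/-- The chain of the underlying objects of `x`, made constant at `τ`, followed by the terminal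
object among the objects that are constant at `τ` and by the terminal object of `Δ ↓ [1]`. -/
def contractChain {L : Type} [LinearOrder L] (τ : Fin 2)
    (x : L ⥤ Over (⦋1⦌ : SimplexCategory)) :
    WithTop (WithTop L) ⥤ Over (⦋1⦌ : SimplexCategory) :=
  extendTop (extendTop (x ⋙ overCollapse) Over.mkIdTerminal ⋙ overVertex τ) Over.mkIdTerminal

theorem contractChain_precomp {L L' : Type} [LinearOrder L] [LinearOrder L'] (θ : L →o L')
    (τ : Fin 2) (x : L' ⥤ Over (⦋1⦌ : SimplexCategory)) :
    contractChain τ (θ.monotone.functor ⋙ x) =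
      (withTopHom (withTopHom θ)).monotone.functor ⋙ contractChain τ x := by
  rw [contractChain, contractChain, extendTop_precomp, ← Functor.assoc, extendTop_precomp]
  rfl

/-! ### Moving the non-constant objects to the terminal object -/

section Homotopies

variable {L L' : Type} [Fintype L] [LinearOrder L] [Fintype L'] [LinearOrder L']

open Classical in
/-- The motion of the vertices of a chain `x` in `Δ ↓ [1]` that keeps the constant objects fixed
and moves the other ones to the terminal object. -/
def slideVertex (x : L ⥤ Over (⦋1⦌ : SimplexCategory)) (t : unitInterval) (i : L) :
    stdSimplex ℝ (WithTop L) :=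
  if IsConst (x.obj i) then stdSimplex.vertex (i : WithTop L) else
    segmentPt (stdSimplex.vertex (i : WithTop L)) (stdSimplex.vertex ⊤) t

theorem continuous_slideVertex (x : L ⥤ Over (⦋1⦌ : SimplexCategory)) (i : L) :
    Continuous fun t => slideVertex x t i := by
  unfold slideVertex
  split_ifs
  · exact continuous_const
  · exact continuous_segmentPt _ _

/-- The chain `x` followed by the terminal object of `Δ ↓ [1]`. -/
def slideChain (x : L ⥤ Over (⦋1⦌ : SimplexCategory)) : WithTop L ⥤ Over (⦋1⦌ : SimplexCategory) :=
  extendTop x Over.mkIdTerminal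

/-- The homotopy on the simplex of a chain in `Δ ↓ [1]` that moves the non-constant objects to the
terminal object. -/
def slideMap (x : L ⥤ Over (⦋1⦌ : SimplexCategory)) :
    C(stdSimplex ℝ L × unitInterval, SSet.toTop.obj (nerve (Over (⦋1⦌ : SimplexCategory)))) :=
  (chainMap (slideChain x)).comp ⟨fun p => affineExtend (slideVertex x p.2) p.1,
    continuous_affineExtend (continuous_slideVertex x)⟩

theorem slideMap_apply (x : L ⥤ Over (⦋1⦌ : SimplexCategory)) (s : stdSimplex ℝ L)
    (t : unitInterval) :
    slideMap x (s, t) = chainMap (slideChain x) (affineExtend (slideVertex x t) s) := rfl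

theorem map_slideVertex (θ : L →o L') (x : L' ⥤ Over (⦋1⦌ : SimplexCategory)) (t : unitInterval)
    (i : L) : stdSimplex.map (withTopHom θ) (slideVertex (θ.monotone.functor ⋙ x) t i) =
      slideVertex x t (θ i) := by
  rw [slideVertex, slideVertex]
  by_cases h : IsConst (x.obj (θ i))
  · have h' : IsConst ((θ.monotone.functor ⋙ x).obj i) := h
    rw [if_pos h, if_pos h', stdSimplex.map_vertex]
    rfl
  · have h' : ¬ IsConst ((θ.monotone.functor ⋙ x).obj i) := h
    rw [if_neg h, if_neg h', map_segmentPt, stdSimplex.map_vertex, stdSimplex.map_vertex]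
    rfl

/-- Whether a vertex moves depends only on its object, so the motion commutes with reindexing on
vertices and, being affine, everywhere. This is the gluing condition. -/
theorem slideMap_precomp (θ : L →o L') (x : L' ⥤ Over (⦋1⦌ : SimplexCategory))
    (s : stdSimplex ℝ L) (t : unitInterval) :
    slideMap (θ.monotone.functor ⋙ x) (s, t) = slideMap x (stdSimplex.map θ s, t) := by
  rw [slideMap_apply, slideMap_apply, slideChain, ← extendTop_precomp, chainMap_precomp,
    map_affineExtend, affineExtend_map]
  congr 2
  funext i
  exact map_slideVertex θ x t i

theorem slideMap_zero [Nonempty L] (x : L ⥤ Over (⦋1⦌ : SimplexCategory)) (s : stdSimplex ℝ L) :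
    slideMap x (s, 0) = chainMap x s := by
  have h : slideVertex x 0 = fun i => stdSimplex.vertex (coeTopHom L i) := by
    funext i
    rw [slideVertex, segmentPt_zero, ite_self]
    rfl
  rw [slideMap_apply, h, affineExtend_vertex, ← chainMap_precomp]
  rfl

theorem slideMap_of_const [Nonempty L] (x : L ⥤ Over (⦋1⦌ : SimplexCategory))
    (hx : ∀ i, IsConst (x.obj i)) (s : stdSimplex ℝ L) (t : unitInterval) :
    slideMap x (s, t) = chainMap x s := by
  rw [← slideMap_zero, slideMap_apply, slideMap_apply]
  congr 2
  funext i
  rw [slideVertex, slideVertex, if_pos (hx i), if_pos (hx i)]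

/-! ### Contracting the constant objects -/

open Classical in
/-- The motion of the vertices of a chain `x` in `Δ ↓ [1]`, with the non-constant objects already
moved to the terminal object, that contracts the constant objects. -/
def contractVertex (x : L ⥤ Over (⦋1⦌ : SimplexCategory)) (t : unitInterval) (i : L) :
    stdSimplex ℝ (WithTop (WithTop L)) :=
  if IsConst (x.obj i) then
    segmentPt (stdSimplex.vertex ((i : WithTop L) : WithTop (WithTop L)))
      (stdSimplex.vertex ((⊤ : WithTop L) : WithTop (WithTop L))) t
  else stdSimplex.vertex ⊤

theorem continuous_contractVertex (x : L ⥤ Over (⦋1⦌ : SimplexCategory)) (i : L) :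
    Continuous fun t => contractVertex x t i := by
  unfold contractVertex
  split_ifs
  · exact continuous_segmentPt _ _
  · exact continuous_const

open Classical in
/-- The vertex of `Δ^1` at which the constant objects of a chain in `Δ ↓ [1]` are constant (`0` if
there are no constant objects). -/
def constEnd (x : L ⥤ Over (⦋1⦌ : SimplexCategory)) : Fin 2 :=
  if ∃ i, IsConstAt 1 (x.obj i) then 1 else 0

theorem IsConst.isConstAt_constEnd {x : L ⥤ Over (⦋1⦌ : SimplexCategory)} {i : L}
    (h : IsConst (x.obj i)) : IsConstAt (constEnd x) (x.obj i) := by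
  obtain ⟨τ, h⟩ := h
  rw [constEnd]
  split_ifs with h1
  · obtain ⟨j, hj⟩ := h1
    rwa [← IsConstAt.of_chain x h hj]
  · match τ, h with
    | 0, h => exact h
    | 1, h => exact (h1 ⟨i, h⟩).elim

/-- The homotopy on the simplex of a chain in `Δ ↓ [1]` that contracts the constant objects, while
the other ones stay at the terminal object. -/
def contractMap (x : L ⥤ Over (⦋1⦌ : SimplexCategory)) :
    C(stdSimplex ℝ L × unitInterval, SSet.toTop.obj (nerve (Over (⦋1⦌ : SimplexCategory)))) :=
  (chainMap (contractChain (constEnd x) x)).comp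
    ⟨fun p => affineExtend (contractVertex x p.2) p.1,
      continuous_affineExtend (continuous_contractVertex x)⟩

theorem contractMap_apply (x : L ⥤ Over (⦋1⦌ : SimplexCategory)) (s : stdSimplex ℝ L)
    (t : unitInterval) :
    contractMap x (s, t) =
      chainMap (contractChain (constEnd x) x) (affineExtend (contractVertex x t) s) := rfl

/-- The end at which the objects are contracted does not matter if there are no constant objects,
and is determined if there are some. -/
theorem contractMap_eq (τ : Fin 2) (x : L ⥤ Over (⦋1⦌ : SimplexCategory))
    (hτ : ∀ i, IsConst (x.obj i) → IsConstAt τ (x.obj i)) (s : stdSimplex ℝ L)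
    (t : unitInterval) :
    contractMap x (s, t) = chainMap (contractChain τ x) (affineExtend (contractVertex x t) s) := by
  rw [contractMap_apply]
  by_cases h : ∃ i, IsConst (x.obj i)
  · obtain ⟨i, hi⟩ := h
    rw [hi.isConstAt_constEnd.unique (hτ i hi)]
  -- Without constant objects all weight is on `⊤`, which is the terminal object for either choice
  -- of end.
  · have : contractVertex x t = fun _ => stdSimplex.vertex ⊤ := by
      funext i
      rw [contractVertex, if_neg fun hi => h ⟨i, hi⟩]
    rw [this, affineExtend_const, chainMap_vertex, chainMap_vertex]
    rfl

theorem map_contractVertex (θ : L →o L') (x : L' ⥤ Over (⦋1⦌ : SimplexCategory))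
    (t : unitInterval) (i : L) :
    stdSimplex.map (withTopHom (withTopHom θ)) (contractVertex (θ.monotone.functor ⋙ x) t i) =
      contractVertex x t (θ i) := by
  rw [contractVertex, contractVertex]
  by_cases h : IsConst (x.obj (θ i))
  · have h' : IsConst ((θ.monotone.functor ⋙ x).obj i) := h
    rw [if_pos h, if_pos h', map_segmentPt, stdSimplex.map_vertex, stdSimplex.map_vertex]
    rfl
  · have h' : ¬ IsConst ((θ.monotone.functor ⋙ x).obj i) := h
    rw [if_neg h, if_neg h', stdSimplex.map_vertex]
    rfl

/-- Reindexing may drop all constant objects and so change `constEnd`; `contractMap_eq` allows the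
end of the larger chain to be used on both sides. -/
theorem contractMap_precomp (θ : L →o L') (x : L' ⥤ Over (⦋1⦌ : SimplexCategory))
    (s : stdSimplex ℝ L) (t : unitInterval) :
    contractMap (θ.monotone.functor ⋙ x) (s, t) = contractMap x (stdSimplex.map θ s, t) := by
  rw [contractMap_eq (constEnd x) _ fun i hi => IsConst.isConstAt_constEnd (i := θ i) hi,
    contractMap_apply, contractChain_precomp, chainMap_precomp, map_affineExtend, affineExtend_map]
  congr 2
  funext i
  exact map_contractVertex θ x t i

open Classical in
/-- Both homotopies meet where the constant objects are fixed and the other ones are at the terminal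
object. -/
theorem contractMap_zero (x : L ⥤ Over (⦋1⦌ : SimplexCategory)) (s : stdSimplex ℝ L) :
    contractMap x (s, 0) = slideMap x (s, 1) := by
  -- Both points lie on the face spanned by the constant objects and the terminal one. On this face
  -- the chains of the two homotopies agree, because making an object constant at `constEnd x`
  -- changes nothing if it is constant already.
  let K : Type := {i : L // IsConst (x.obj i)}
  let ι : K →o L := ⟨Subtype.val, fun _ _ h => h⟩
  let g : L → WithTop K := fun i => if h : IsConst (x.obj i) then ((⟨i, h⟩ : K) : WithTop K) else ⊤
  let j : WithTop L →o WithTop (WithTop L) := withTopHom (coeTopHom L)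
  have h1 : slideVertex x 1 = fun i => stdSimplex.vertex (withTopHom ι (g i)) := by
    funext i
    simp only [slideVertex, g, segmentPt_one]
    split_ifs <;> rfl
  have h0 : contractVertex x 0 = fun i => stdSimplex.vertex (j (withTopHom ι (g i))) := by
    funext i
    simp only [contractVertex, g, segmentPt_zero]
    split_ifs <;> rfl
  rw [contractMap_apply, slideMap_apply, h0, h1, affineExtend_vertex, affineExtend_vertex]
  have e0 : stdSimplex.map (fun i => j (withTopHom ι (g i))) s =
      stdSimplex.map j (stdSimplex.map (withTopHom ι) (stdSimplex.map g s)) := by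
    rw [stdSimplex.map_comp_apply, stdSimplex.map_comp_apply]
    rfl
  have e1 : stdSimplex.map (fun i => withTopHom ι (g i)) s =
      stdSimplex.map (withTopHom ι) (stdSimplex.map g s) := by
    rw [stdSimplex.map_comp_apply]
    rfl
  rw [e0, e1, ← chainMap_precomp, ← chainMap_precomp, ← chainMap_precomp, slideChain,
    contractChain, extendTop_precomp, extendTop_precomp, extendTop_precomp]
  congr 2
  have := comp_overCollapse_overVertex (ι.monotone.functor ⋙ x) (τ := constEnd x)
    fun i => IsConst.isConstAt_constEnd i.2
  congr 1

/-- The edge from the terminal object among those that are constant at `τ` to the terminal object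
of `Δ ↓ [1]`. -/
def edgeMap (τ : Fin 2) :
    C(stdSimplex ℝ (WithTop Unit), SSet.toTop.obj (nerve (Over (⦋1⦌ : SimplexCategory)))) :=
  chainMap (extendTop ((Functor.const Unit).obj ((overVertex τ).obj (Over.mk (𝟙 _))))
    Over.mkIdTerminal)

-- At time `1` only two objects carry weight: the terminal one among those constant at the chosen
-- end, and the terminal object of `Δ ↓ [1]`. They span the edge.
open Classical in
theorem contractMap_one (x : L ⥤ Over (⦋1⦌ : SimplexCategory)) (s : stdSimplex ℝ L) :
    contractMap x (s, 1) = edgeMap (constEnd x) (stdSimplex.map (fun i =>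
      if IsConst (x.obj i) then ((() : Unit) : WithTop Unit) else ⊤) s) := by
  let θ : Unit →o WithTop L := ⟨fun _ => ⊤, fun _ _ _ => le_rfl⟩
  have h1 : contractVertex x 1 = fun i => stdSimplex.vertex (withTopHom θ
      (if IsConst (x.obj i) then ((() : Unit) : WithTop Unit) else ⊤)) := by
    funext i
    simp only [contractVertex, segmentPt_one]
    split_ifs <;> rfl
  have e1 : stdSimplex.map (fun i => withTopHom θ
      (if IsConst (x.obj i) then ((() : Unit) : WithTop Unit) else ⊤)) s =
      stdSimplex.map (withTopHom θ) (stdSimplex.map (fun i =>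
        if IsConst (x.obj i) then ((() : Unit) : WithTop Unit) else ⊤) s) := by
    rw [stdSimplex.map_comp_apply]
    rfl
  rw [contractMap_apply, h1, affineExtend_vertex, e1, ← chainMap_precomp, contractChain,
    extendTop_precomp, edgeMap]
  congr 3
  exact CategoryTheory.Functor.hext (fun _ => rfl)
    (fun _ _ _ => heq_of_eq (CategoryTheory.Functor.map_id _ _))

/-- No weight reaches the outer `⊤`, and the rest of the chain comes from `Δ ↓ [0]`. Hence the
contraction preserves the two ends, as a homotopy of pairs must. -/
theorem contractMap_overVertex [Nonempty L] (τ : Fin 2) (c : L ⥤ Over (⦋0⦌ : SimplexCategory))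
    (s : stdSimplex ℝ L) (t : unitInterval) :
    ∃ τ' w, contractMap (c ⋙ overVertex τ) (s, t) =
      (SSet.toTop.map (nerveMap (overVertex τ'))).hom w := by
  have h : contractVertex (c ⋙ overVertex τ) t = fun i : L => stdSimplex.map (coeTopHom (WithTop L))
      (segmentPt (stdSimplex.vertex (i : WithTop L)) (stdSimplex.vertex ⊤) t) := by
    funext i
    rw [contractVertex, if_pos ⟨τ, isConstAt_overVertex τ _⟩, map_segmentPt,
      stdSimplex.map_vertex, stdSimplex.map_vertex]
    rfl
  rw [contractMap_apply, h, ← map_affineExtend, ← chainMap_precomp, contractChain,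
    coeTop_extendTop, ← toTop_map_chainMap]
  exact ⟨_, _, rfl⟩

end Homotopies

/-! ### Spaces of maps that are constant on a subspace -/

/-- The space of maps `A → X` that send `S` to the point `x₀`. -/
abbrev RelMap {A : Type} [TopologicalSpace A] (S : Set A) {X : Type} [TopologicalSpace X] (x₀ : X) :
    Type := {g : C(A, X) // ∀ a ∈ S, g a = x₀}

section RelMap

variable {A B X : Type} [TopologicalSpace A] [TopologicalSpace B] [TopologicalSpace X]

/-- Precomposition with a map of pairs. -/
def precompRel {S : Set A} {T : Set B} (u : C(A, B)) (hu : Set.MapsTo u S T) (x₀ : X) :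
    C(RelMap T x₀, RelMap S x₀) where
  toFun g := ⟨g.1.comp u, fun _ ha => g.2 _ (hu ha)⟩
  continuous_toFun :=
    ((ContinuousMap.continuous_precomp u).comp continuous_subtype_val).subtype_mk _

/-- Local compactness is asked of the parameter space only; `A` will be the realization of a nerve.
The tube lemma thickens the time `t` to a compact neighbourhood `N`, and `K ×ˢ N` tests `G`. -/
theorem continuous_comp_slice {T : Type} [TopologicalSpace T] [LocallyCompactSpace T] :
    Continuous fun p : T × C(A × T, X) =>
      p.2.comp (ContinuousMap.prodMk (ContinuousMap.id A) (ContinuousMap.const A p.1)) := by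
  simp_rw [continuous_iff_continuousAt, ContinuousAt, ContinuousMap.tendsto_nhds_compactOpen]
  rintro ⟨t, G⟩ K hK U hU h
  obtain ⟨V, W, -, hW, hKV, htW, hVW⟩ := generalized_tube_lemma hK (isCompact_singleton (x := t))
    (hU.preimage G.continuous) (by
      rintro ⟨a, t'⟩ ⟨ha, rfl⟩
      exact h ha)
  obtain ⟨N, hN, hNW, hNc⟩ := local_compact_nhds (hW.mem_nhds (htW rfl))
  have hG : Set.MapsTo G (K ×ˢ N) U := fun p hp => hVW ⟨hKV hp.1, hNW hp.2⟩
  filter_upwards [prod_mem_nhds hN (ContinuousMap.eventually_mapsTo (hK.prod hNc) hU hG)]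
  rintro ⟨t', G'⟩ ⟨ht', hG'⟩ a ha
  exact hG' ⟨ha, ht'⟩

/-- A homotopy of maps of pairs induces a homotopy between the precomposition maps. -/
theorem precompRel_homotopic {S : Set A} {T : Set B} {u v : C(A, B)} (hu : Set.MapsTo u S T)
    (hv : Set.MapsTo v S T) (x₀ : X) (H : C(A × unitInterval, B)) (h0 : ∀ a, H (a, 0) = u a)
    (h1 : ∀ a, H (a, 1) = v a) (hH : ∀ a ∈ S, ∀ t, H (a, t) ∈ T) :
    (precompRel u hu x₀).Homotopic (precompRel v hv x₀) := by
  refine ⟨⟨⟨fun p => ⟨(p.2.1.comp H).comp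
    (ContinuousMap.prodMk (ContinuousMap.id A) (ContinuousMap.const A p.1)),
      fun a ha => p.2.2 _ (hH a ha _)⟩, ?_⟩, ?_, ?_⟩⟩
  · refine Continuous.subtype_mk (continuous_comp_slice.comp (continuous_fst.prodMk ?_)) _
    exact (ContinuousMap.continuous_precomp H).comp (continuous_subtype_val.comp continuous_snd)
  · intro g
    exact Subtype.ext (ContinuousMap.ext fun a => congr_arg g.1 (h0 a))
  · intro g
    exact Subtype.ext (ContinuousMap.ext fun a => congr_arg g.1 (h1 a))

end RelMap

/-! ### The homotopy equivalence of `|N(Δ ↓ [1])|` with the interval -/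

/-- The realization of the nerve of `Δ ↓ [1]`. -/
abbrev OverOneRealization : Type := SSet.toTop.obj (nerve (Over (⦋1⦌ : SimplexCategory)))

/-- The two copies of the realization of the nerve of `Δ ↓ [0]` inside that of `Δ ↓ [1]`. -/
def overEnds : Set OverOneRealization :=
  {w | ∃ τ z, (SSet.toTop.map (nerveMap (overVertex τ))).hom z = w}

/-- The two vertices of the interval `Δ^1`. -/
def simplexEnds : Set (stdSimplex ℝ (Fin 2)) := {p | ∃ τ : Fin 2, p = stdSimplex.vertex τ}

/-- The midpoint of `Δ^1`. -/
def simplexMid : stdSimplex ℝ (Fin 2) :=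
  segmentPt (stdSimplex.vertex 0) (stdSimplex.vertex 1) ⟨1 / 2, by norm_num, by norm_num⟩

open Classical in
/-- The position in `Δ^1` of an object of `Δ ↓ [1]`. -/
def objPosition (e : Over (⦋1⦌ : SimplexCategory)) : stdSimplex ℝ (Fin 2) :=
  if IsConstAt 0 e then stdSimplex.vertex 0 else
    if IsConstAt 1 e then stdSimplex.vertex 1 else simplexMid

theorem objPosition_of_isConstAt {τ : Fin 2} {e : Over (⦋1⦌ : SimplexCategory)}
    (h : IsConstAt τ e) : objPosition e = stdSimplex.vertex τ := by
  match τ, h with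
  | 0, h => rw [objPosition, if_pos h]
  | 1, h =>
    rw [objPosition, if_neg (fun h0 => Fin.zero_ne_one (h0.unique h)), if_pos h]

theorem objPosition_of_not_isConst {e : Over (⦋1⦌ : SimplexCategory)} (h : ¬ IsConst e) :
    objPosition e = simplexMid := by
  rw [objPosition, if_neg fun h0 => h ⟨0, h0⟩, if_neg fun h1 => h ⟨1, h1⟩]

theorem not_isConst_id : ¬ IsConst (Over.mk (𝟙 (⦋1⦌ : SimplexCategory))) := by
  rintro ⟨τ, h⟩
  exact Fin.zero_ne_one ((h 0).trans (h 1).symm)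

/-- Affine extension of `objPosition` commutes with reindexing of chains, so the maps on simplices
glue. -/
theorem exists_position : ∃ u : C(OverOneRealization, stdSimplex ℝ (Fin 2)),
    ∀ (L : Type) [Fintype L] [LinearOrder L] [Nonempty L]
      (x : L ⥤ Over (⦋1⦌ : SimplexCategory)) (s : stdSimplex ℝ L),
        u (chainMap x s) = affineExtend (fun i => objPosition (x.obj i)) s :=
  exists_nerve_desc (fun _ _ _ _ x => ⟨fun s => affineExtend (fun i => objPosition (x.obj i)) s,
    (continuous_affineExtend (T := Unit) (M := fun _ i => objPosition (x.obj i))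
      (fun _ => continuous_const)).comp (continuous_id.prodMk (continuous_const (y := ())))⟩)
    (fun _ _ _ _ _ _ _ _ θ x s => (affineExtend_map (fun i => objPosition (x.obj i)) θ s).symm)

theorem exists_slide : ∃ H : C(OverOneRealization × unitInterval, OverOneRealization),
    ∀ (L : Type) [Fintype L] [LinearOrder L] [Nonempty L]
      (x : L ⥤ Over (⦋1⦌ : SimplexCategory)) (s : stdSimplex ℝ L) (t : unitInterval),
        H (chainMap x s, t) = slideMap x (s, t) :=
  exists_nerve_homotopy (fun _ _ _ _ x => slideMap x)
    (fun _ _ _ _ _ _ _ _ θ x s t => slideMap_precomp θ x s t)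

theorem exists_contract : ∃ H : C(OverOneRealization × unitInterval, OverOneRealization),
    ∀ (L : Type) [Fintype L] [LinearOrder L] [Nonempty L]
      (x : L ⥤ Over (⦋1⦌ : SimplexCategory)) (s : stdSimplex ℝ L) (t : unitInterval),
        H (chainMap x s, t) = contractMap x (s, t) :=
  exists_nerve_homotopy (fun _ _ _ _ x => contractMap x)
    (fun _ _ _ _ _ _ _ _ θ x s t => contractMap_precomp θ x s t)

/-- The path along an edge. -/
def edgePath (τ : Fin 2) :
    Path (objPt ((overVertex τ).obj (Over.mk (𝟙 _))))
      (objPt (Over.mk (𝟙 (⦋1⦌ : SimplexCategory)))) where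
  toFun r := edgeMap τ (segmentPt (stdSimplex.vertex ((() : Unit) : WithTop Unit))
    (stdSimplex.vertex ⊤) r)
  continuous_toFun := (edgeMap τ).continuous.comp (continuous_segmentPt _ _)
  source' := by
    rw [segmentPt_zero, edgeMap, chainMap_vertex]
    rfl
  target' := by
    rw [segmentPt_one, edgeMap, chainMap_vertex]
    rfl

/-- The path formed by the two edges. -/
def edgesPath : Path (objPt ((overVertex 0).obj (Over.mk (𝟙 _))))
    (objPt ((overVertex 1).obj (Over.mk (𝟙 _)))) :=
  (edgePath 0).trans (edgePath 1).symm

/-- The inclusion of the interval `Δ^1` as the union of the two edges. -/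
def edgesMap : C(stdSimplex ℝ (Fin 2), OverOneRealization) :=
  edgesPath.toContinuousMap.comp ⟨_, stdSimplexHomeomorphUnitInterval.continuous⟩

theorem edgesMap_apply (p : stdSimplex ℝ (Fin 2)) :
    edgesMap p = edgesPath (stdSimplexHomeomorphUnitInterval p) := rfl

theorem trans_half {Z : Type} [TopologicalSpace Z] {a b c : Z} (γ : Path a b) (γ' : Path b c)
    (r : unitInterval) : (γ.trans γ') ⟨r / 2, by linarith [r.2.1], by linarith [r.2.2]⟩ = γ r := by
  rw [Path.trans_apply, dif_pos (by simpa using by linarith [r.2.2])]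
  congr 1
  ext
  simp only
  ring

theorem stdSimplex_fin_two_ext {p q : stdSimplex ℝ (Fin 2)} (h : p 1 = q 1) : p = q := by
  ext i
  have hp := stdSimplex.add_eq_one p
  have hq := stdSimplex.add_eq_one q
  match i with
  | 0 => linarith
  | 1 => exact h

/-- The position of a point of an edge. -/
def edgePosition (τ : Fin 2) (q : stdSimplex ℝ (WithTop Unit)) : stdSimplex ℝ (Fin 2) :=
  affineExtend (fun i : WithTop Unit => if i = ⊤ then simplexMid else stdSimplex.vertex τ) q

theorem withTop_unit_sum (f : WithTop Unit → ℝ) :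
    ∑ i, f i = f ⊤ + f ((() : Unit) : WithTop Unit) :=
  (Fintype.sum_option f).trans (by simp; rfl)

theorem eq_segmentPt (q : stdSimplex ℝ (WithTop Unit)) :
    q = segmentPt (stdSimplex.vertex ((() : Unit) : WithTop Unit)) (stdSimplex.vertex ⊤)
      ⟨q ⊤, q.2.1 _, stdSimplex.le_one q _⟩ := by
  have h := stdSimplex.sum_eq_one q
  rw [withTop_unit_sum] at h
  ext i
  match i with
  | ⊤ => simp [segmentPt_apply]
  | (() : Unit) =>
    simp [segmentPt_apply]
    linarith

theorem edgePosition_zero_one (q : stdSimplex ℝ (WithTop Unit)) : edgePosition 0 q 1 = q ⊤ / 2 := by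
  rw [edgePosition, affineExtend_apply, withTop_unit_sum]
  simp [simplexMid, segmentPt_apply]
  ring

theorem edgePosition_one_one (q : stdSimplex ℝ (WithTop Unit)) :
    edgePosition 1 q 1 = 1 - q ⊤ / 2 := by
  have h := stdSimplex.sum_eq_one q
  rw [withTop_unit_sum] at h
  rw [edgePosition, affineExtend_apply, withTop_unit_sum]
  simp [simplexMid, segmentPt_apply]
  linarith

/-- If `q` has weight `r` on the terminal object, its position has coordinate `r / 2` on edge `0`
and `1 - r / 2` on edge `1`. The concatenated path at `r / 2` is the first edge at time `r`;
reversing the path reduces the second case to the first. -/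
theorem edgesMap_edgePosition (τ : Fin 2) (q : stdSimplex ℝ (WithTop Unit)) :
    edgesMap (edgePosition τ q) = edgeMap τ q := by
  let r : unitInterval := ⟨q ⊤, q.2.1 _, stdSimplex.le_one q _⟩
  have hq : edgeMap τ q = edgePath τ r := congr_arg (edgeMap τ) (eq_segmentPt q)
  rw [hq, edgesMap_apply]
  match τ with
  | 0 =>
    rw [← trans_half (edgePath 0) (edgePath 1).symm r]
    exact congr_arg edgesPath (Subtype.ext (edgePosition_zero_one q))
  | 1 =>
    rw [← trans_half (edgePath 1) (edgePath 0).symm r]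
    have : (edgePath 1).trans (edgePath 0).symm = edgesPath.symm := by
      rw [edgesPath, Path.trans_symm, Path.symm_symm]
    rw [this, Path.symm_apply]
    refine congr_arg edgesPath (Subtype.ext ((edgePosition_one_one q).trans ?_))
    rfl

theorem exists_edgePosition_eq (p : stdSimplex ℝ (Fin 2)) : ∃ τ q, edgePosition τ q = p := by
  have h0 := stdSimplex.zero_le p 1
  have h1 := stdSimplex.le_one p 1
  rcases le_total (p 1) (1 / 2) with h | h
  -- The weights `2 * p 1` here and `2 - 2 * p 1` below invert the formulas for the position on the
  -- two edges.
  · refine ⟨0, segmentPt (stdSimplex.vertex ((() : Unit) : WithTop Unit)) (stdSimplex.vertex ⊤)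
      ⟨2 * p 1, by linarith, by linarith⟩, stdSimplex_fin_two_ext ?_⟩
    rw [edgePosition_zero_one]
    simp [segmentPt_apply]
  · refine ⟨1, segmentPt (stdSimplex.vertex ((() : Unit) : WithTop Unit)) (stdSimplex.vertex ⊤)
      ⟨2 - 2 * p 1, by linarith, by linarith⟩, stdSimplex_fin_two_ext ?_⟩
    rw [edgePosition_one_one]
    simp [segmentPt_apply]
    ring

theorem mapsTo_edgesMap : Set.MapsTo edgesMap simplexEnds overEnds := by
  rintro _ ⟨τ, rfl⟩
  have h : edgesMap (stdSimplex.vertex τ) = objPt ((overVertex τ).obj (Over.mk (𝟙 _))) := by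
    rw [edgesMap_apply]
    match τ with
    | 0 => exact edgesPath.source
    | 1 => exact edgesPath.target
  rw [h]
  exact ⟨τ, objPt (Over.mk (𝟙 _)), toTop_map_chainMap (overVertex τ) _ _⟩

open Classical in
/-- The maps of `|N(Δ ↓ [1])|` that are constant on both copies of `|N(Δ ↓ [0])|` are, up to
homotopy, the maps of `Δ^1` that are constant on the vertices. -/
theorem nonempty_homotopyEquiv_relMap {X : Type} [TopologicalSpace X] (x₀ : X) :
    Nonempty (ContinuousMap.HomotopyEquiv (RelMap overEnds x₀) (RelMap simplexEnds x₀)) := by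
  obtain ⟨u, hu⟩ := exists_position
  obtain ⟨H₁, hH₁⟩ := exists_slide
  obtain ⟨H₂, hH₂⟩ := exists_contract
  have uEnds : Set.MapsTo u overEnds simplexEnds := by
    rintro _ ⟨τ, z, rfl⟩
    obtain ⟨n, c, s, rfl⟩ := exists_chainMap_eq z
    refine ⟨τ, ?_⟩
    rw [toTop_map_chainMap, hu]
    have : (fun i => objPosition ((c ⋙ overVertex τ).obj i)) = fun _ => stdSimplex.vertex τ :=
      funext fun i => objPosition_of_isConstAt (isConstAt_overVertex τ _)
    rw [this, affineExtend_const]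
  have uEdge : ∀ τ q, u (edgeMap τ q) = edgePosition τ q := fun τ q => by
    rw [edgeMap, hu, edgePosition]
    congr 1
    funext i
    match i with
    | ⊤ => exact objPosition_of_not_isConst not_isConst_id
    | (() : Unit) => exact objPosition_of_isConstAt (isConstAt_overVertex τ _)
  -- Every point of the interval is the position of a point of one of the edges, and on the edges
  -- `u` is that position.
  have uv : u.comp edgesMap = ContinuousMap.id _ := by
    ext1 p
    obtain ⟨τ, q, rfl⟩ := exists_edgePosition_eq p
    rw [ContinuousMap.comp_apply, edgesMap_edgePosition, uEdge]
    rfl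
  -- Both sides see only which objects of the chain are constant, and at which end.
  have vu : ∀ w, edgesMap (u w) = H₂ (w, 1) := fun w => by
    obtain ⟨n, x, s, rfl⟩ := exists_chainMap_eq w
    rw [hH₂, contractMap_one, ← edgesMap_edgePosition, hu, edgePosition, affineExtend_map]
    congr 2
    funext i
    simp only [Function.comp]
    split_ifs with h h' h'
    · exact (WithTop.coe_ne_top h').elim
    · exact objPosition_of_isConstAt h.isConstAt_constEnd
    · exact objPosition_of_not_isConst h
    · exact (h' rfl).elim
  have ends₁ : ∀ w ∈ overEnds, ∀ t, H₁ (w, t) ∈ overEnds := by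
    rintro _ ⟨τ, z, rfl⟩ t
    obtain ⟨n, c, s, rfl⟩ := exists_chainMap_eq z
    rw [toTop_map_chainMap, hH₁, slideMap_of_const _ fun i => ⟨τ, isConstAt_overVertex τ _⟩]
    exact ⟨τ, _, toTop_map_chainMap _ _ _⟩
  have ends₂ : ∀ w ∈ overEnds, ∀ t, H₂ (w, t) ∈ overEnds := by
    rintro _ ⟨τ, z, rfl⟩ t
    obtain ⟨n, c, s, rfl⟩ := exists_chainMap_eq z
    rw [toTop_map_chainMap, hH₂]
    obtain ⟨τ', w, hw⟩ := contractMap_overVertex τ c s t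
    exact ⟨τ', w, hw.symm⟩
  have start : ∀ w, H₁ (w, 0) = w := fun w => by
    obtain ⟨n, x, s, rfl⟩ := exists_chainMap_eq w
    rw [hH₁, slideMap_zero]
  have meet : ∀ w, H₂ (w, 0) = H₁ (w, 1) := fun w => by
    obtain ⟨n, x, s, rfl⟩ := exists_chainMap_eq w
    rw [hH₁, hH₂, contractMap_zero]
  -- The intermediate map, where the slide stops and the contraction starts.
  let m : C(OverOneRealization, OverOneRealization) :=
    H₁.comp (ContinuousMap.prodMk (ContinuousMap.id _) (ContinuousMap.const _ 1))
  have hm : Set.MapsTo m overEnds overEnds := fun w hw => ends₁ w hw 1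
  have hvu : Set.MapsTo (edgesMap.comp u) overEnds overEnds := mapsTo_edgesMap.comp uEnds
  refine ⟨⟨precompRel edgesMap mapsTo_edgesMap x₀, precompRel u uEnds x₀, ?_, ?_⟩⟩
  · have k₁ := precompRel_homotopic (Set.mapsTo_id overEnds) hm x₀ H₁ start (fun _ => rfl) ends₁
      (u := ContinuousMap.id _)
    have k₂ := precompRel_homotopic hm hvu x₀ H₂ meet (fun w => (vu w).symm) ends₂
    exact (k₁.trans k₂).symm
  · have : (precompRel edgesMap mapsTo_edgesMap x₀).comp (precompRel u uEnds x₀) =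
        ContinuousMap.id _ := by
      ext1 g
      refine Subtype.ext ?_
      change (g.1.comp u).comp edgesMap = g.1
      rw [ContinuousMap.comp_assoc, uv, ContinuousMap.comp_id]
    rw [this]

/-! ### Continuity of maps into spaces of maps to a product -/

section Product

variable {K T A B : Type} [TopologicalSpace K] [TopologicalSpace T] [UniformSpace A]
  [UniformSpace B]

/-- With uniform targets the compact-open topology is uniform convergence on compact sets, which is
checked in each factor. No separation or local compactness of `K` is needed, so realizations of
nerves are admissible. -/
theorem continuous_prodMk_mapSpace {f : T → C(K, A)} {g : T → C(K, B)} (hf : Continuous f)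
    (hg : Continuous g) : Continuous fun t => ContinuousMap.prodMk (f t) (g t) := by
  rw [continuous_iff_continuousAt] at *
  intro t
  have h1 := ContinuousMap.tendsto_iff_forall_isCompact_tendstoUniformlyOn.1 (hf t)
  have h2 := ContinuousMap.tendsto_iff_forall_isCompact_tendstoUniformlyOn.1 (hg t)
  exact ContinuousMap.tendsto_iff_forall_isCompact_tendstoUniformlyOn.2 fun Q hQ =>
    fun u hu => Filter.Eventually.diag_of_prod (((h1 Q hQ).prodMk (h2 Q hQ)) u hu)

theorem continuous_pi_mapSpace {ι : Type} [Finite ι] {f : ι → T → C(K, A)}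
    (hf : ∀ i, Continuous (f i)) : Continuous fun t => ContinuousMap.pi fun i => f i t := by
  simp_rw [continuous_iff_continuousAt] at *
  intro t
  refine ContinuousMap.tendsto_iff_forall_isCompact_tendstoUniformlyOn.2 fun Q hQ => ?_
  have h := fun i => ContinuousMap.tendsto_iff_forall_isCompact_tendstoUniformlyOn.1 (hf i t) Q hQ
  simp_rw [tendstoUniformlyOn_iff_tendsto] at h ⊢
  rw [Pi.uniformity, Filter.tendsto_iInf]
  exact fun i => Filter.tendsto_comap_iff.2 (h i)

end Product

/-! ### Cosimplicial maps into the cobar construction -/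

/-- The images of the two cofaces `K^0 → K^1`. -/
def cosimplicialEnds (K : CosimplicialObject TopCat.{0}) : Set (K.obj ⦋1⦌) :=
  {w | ∃ (θ : (⦋0⦌ : SimplexCategory) ⟶ ⦋1⦌) (z : K.obj ⦋0⦌), (K.map θ).hom z = w}

/-- The map `[p] → [1]` that sends `i` to `0` exactly if `i < j`. -/
def cutMap (p : SimplexCategory) (j : Fin (p.len + 2)) : p ⟶ ⦋1⦌ :=
  SimplexCategory.Hom.mk ⟨fun i => if (i : ℕ) < j then (0 : Fin 2) else 1, by
    intro i i' h
    have h' : (i : ℕ) ≤ i' := h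
    dsimp only
    split_ifs
    · exact le_rfl
    · exact Fin.zero_le _
    · omega
    · exact le_rfl⟩

theorem cutMap_apply (p : SimplexCategory) (j : Fin (p.len + 2)) (i : Fin (p.len + 1)) :
    (cutMap p j).toOrderHom i = if (i : ℕ) < j then (0 : Fin 2) else 1 := rfl

/-- This is the meaning of `gapMap`: it pulls back cuts. Hence the cobar construction permutes,
repeats and drops coordinates exactly as composition acts on cuts. -/
theorem comp_cutMap {p q : SimplexCategory} (θ : p ⟶ q) (j : Fin (q.len + 2)) :
    θ ≫ cutMap q j = cutMap p (gapMap θ j) := by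
  ext i : 3
  change (cutMap q j).toOrderHom (θ.toOrderHom i) = _
  rw [cutMap_apply, cutMap_apply]
  exact if_congr (lt_gapMap_iff θ j i).symm rfl rfl

/-- Says that the structure map of the `j`-th cut is the projection of the extended tuple to its
`j`-th entry. -/
theorem gapMap_cutMap (p : SimplexCategory) (j : Fin (p.len + 2)) :
    gapMap (cutMap p j) (1 : Fin 3) = j :=
  gapMap_eq _ _ _ fun i => by
    rw [cutMap_apply]
    split_ifs with h <;> simp [h]

theorem cutMap_one : cutMap ⦋1⦌ (1 : Fin 3) = 𝟙 _ := by
  ext i : 3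
  rw [cutMap_apply]
  match i with
  | (0 : Fin 2) => rfl
  | (1 : Fin 2) => rfl

/-- The cut in front of all elements is constant at `1`, so it factors through `[0]`. -/
theorem map_cutMap_zero_mem (K : CosimplicialObject TopCat.{0}) (p : SimplexCategory)
    (w : K.obj p) : (K.map (cutMap p 0)).hom w ∈ cosimplicialEnds K := by
  have h : cutMap p 0 = SimplexCategory.isTerminalZero.from p ≫
      SimplexCategory.const ⦋0⦌ ⦋1⦌ 1 := by
    ext i : 3
    rw [cutMap_apply]
    rfl
  refine ⟨SimplexCategory.const ⦋0⦌ ⦋1⦌ 1,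
    (K.map (SimplexCategory.isTerminalZero.from p)).hom w, ?_⟩
  rw [h, K.map_comp]
  rfl

theorem map_cutMap_last_mem (K : CosimplicialObject TopCat.{0}) (p : SimplexCategory)
    (w : K.obj p) : (K.map (cutMap p (Fin.last _))).hom w ∈ cosimplicialEnds K := by
  have h : cutMap p (Fin.last _) = SimplexCategory.isTerminalZero.from p ≫
      SimplexCategory.const ⦋0⦌ ⦋1⦌ 0 := by
    ext i : 3
    rw [cutMap_apply, if_pos (by simpa using i.isLt)]
    rfl
  refine ⟨SimplexCategory.const ⦋0⦌ ⦋1⦌ 0,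
    (K.map (SimplexCategory.isTerminalZero.from p)).hom w, ?_⟩
  rw [h, K.map_comp]
  rfl

/-- Loops are the maps of `Δ^1` that send both vertices to the base point. -/
def relMapSimplexHomeo {X : Type} [TopologicalSpace X] (x₀ : X) :
    RelMap simplexEnds x₀ ≃ₜ Path x₀ x₀ where
  toFun g :=
    { toContinuousMap := g.1.comp ⟨_, stdSimplexHomeomorphUnitInterval.symm.continuous⟩
      source' := g.2 _ ⟨0, stdSimplexHomeomorphUnitInterval.symm_apply_eq.2
        stdSimplexHomeomorphUnitInterval_zero.symm⟩
      target' := g.2 _ ⟨1, stdSimplexHomeomorphUnitInterval.symm_apply_eq.2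
        stdSimplexHomeomorphUnitInterval_one.symm⟩ }
  invFun γ := ⟨γ.toContinuousMap.comp ⟨_, stdSimplexHomeomorphUnitInterval.continuous⟩, by
    rintro _ ⟨τ, rfl⟩
    match τ with
    | 0 => exact γ.source
    | 1 => exact γ.target⟩
  left_inv g := Subtype.ext (ContinuousMap.ext fun p =>
    congr_arg g.1 (stdSimplexHomeomorphUnitInterval.symm_apply_apply p))
  right_inv γ := Path.ext (funext fun r =>
    congr_arg γ (stdSimplexHomeomorphUnitInterval.apply_symm_apply r))
  continuous_toFun := continuous_induced_rng.2
    ((ContinuousMap.continuous_precomp _).comp continuous_subtype_val)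
  continuous_invFun := Continuous.subtype_mk
    ((ContinuousMap.continuous_precomp _).comp continuous_induced_dom) _

section Cobar

variable (K : CosimplicialObject TopCat.{0}) {X : Type} [UniformSpace X] (x₀ : X)

theorem mapSpace_apply {K Y : CosimplicialObject TopCat.{0}} (f : MapSpace K Y)
    {p q : SimplexCategory} (θ : p ⟶ q) (w : K.obj p) :
    (Y.map θ).hom (f.1 p w) = f.1 q ((K.map θ).hom w) :=
  congr_arg (fun g : C(K.obj p, Y.obj q) => g w) (f.2 θ)

theorem cobar_map_apply {p q : SimplexCategory} (θ : p ⟶ q) (x : Fin p.len → X) (k : Fin q.len) :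
    (show Fin q.len → X from ((cobar X x₀).map θ).hom x) k =
      withEnds x₀ x₀ x (gapMap θ k.succ.castSucc) := rfl

/-- The component `K^p → X^p` of a cosimplicial map to the cobar construction. -/
def cobarComponent {K : CosimplicialObject TopCat.{0}} {x₀ : X} (f : MapSpace K (cobar X x₀))
    (p : SimplexCategory) : C(K.obj p, Fin p.len → X) := f.1 p

theorem withEnds_cobarComponent {K : CosimplicialObject TopCat.{0}} {x₀ : X}
    (f : MapSpace K (cobar X x₀)) {p q : SimplexCategory} (θ : p ⟶ q) (w : K.obj p)
    (k : Fin q.len) :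
    withEnds x₀ x₀ (cobarComponent f p w) (gapMap θ k.succ.castSucc) =
      cobarComponent f q ((K.map θ).hom w) k :=
  congr_fun (mapSpace_apply f θ w) k

/-- A tuple of length `0` has no entries of its own, so a coface can only insert the base point. -/
theorem cobarComponent_of_mem {K : CosimplicialObject TopCat.{0}} {x₀ : X}
    (f : MapSpace K (cobar X x₀)) (w : K.obj ⦋1⦌) (hw : w ∈ cosimplicialEnds K) :
    cobarComponent f ⦋1⦌ w (0 : Fin 1) = x₀ := by
  obtain ⟨θ, z, rfl⟩ := hw
  refine (withEnds_cobarComponent f θ z (0 : Fin 1)).symm.trans ?_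
  rcases end_cases (gapMap θ (0 : Fin 1).succ.castSucc) with h | h | ⟨k, -⟩
  · exact (congr_arg _ h).trans (withEnds_zero _ _ _)
  · exact (congr_arg _ h).trans (withEnds_last _ _ _)
  · exact k.elim0

/-- The cosimplicial map to the cobar construction determined by its first component. -/
def cobarExtend (g : RelMap (cosimplicialEnds K) x₀) (p : SimplexCategory) :
    C(K.obj p, Fin p.len → X) :=
  ContinuousMap.pi fun k => g.1.comp (K.map (cutMap p k.succ.castSucc)).hom

variable {K x₀} in
theorem withEnds_cobarExtend (g : RelMap (cosimplicialEnds K) x₀) (p : SimplexCategory)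
    (w : K.obj p) (j : Fin (p.len + 2)) :
    withEnds x₀ x₀ (cobarExtend K x₀ g p w) j = g.1 ((K.map (cutMap p j)).hom w) := by
  rcases end_cases j with rfl | rfl | ⟨k, rfl⟩
  · rw [withEnds_zero, g.2 _ (map_cutMap_zero_mem K p w)]
  · rw [withEnds_last, g.2 _ (map_cutMap_last_mem K p w)]
  · rw [withEnds_mid]
    rfl

theorem continuous_cobarExtend (p : SimplexCategory) :
    Continuous fun g : RelMap (cosimplicialEnds K) x₀ => cobarExtend K x₀ g p :=
  continuous_pi_mapSpace fun k =>
    (ContinuousMap.continuous_precomp (K.map (cutMap p k.succ.castSucc)).hom).comp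
      continuous_subtype_val

/-- A cosimplicial map to the cobar construction is determined by its first component, which may be
any map that sends the images of both cofaces to the base point. -/
def mapSpaceCobarHomeo : MapSpace K (cobar X x₀) ≃ₜ RelMap (cosimplicialEnds K) x₀ where
  toFun f := ⟨(⟨fun c : Fin 1 → X => c 0, continuous_apply 0⟩ : C(Fin 1 → X, X)).comp
      (cobarComponent f ⦋1⦌), fun w hw => cobarComponent_of_mem f w hw⟩
  invFun g := ⟨cobarExtend K x₀ g, fun p q θ => ContinuousMap.ext fun w => funext fun k => by
    refine (cobar_map_apply x₀ θ (cobarExtend K x₀ g p w) k).trans ?_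
    refine (withEnds_cobarExtend g p w _).trans ?_
    rw [← comp_cutMap, K.map_comp]
    rfl⟩
  left_inv f := by
    refine Subtype.ext (funext fun p => ContinuousMap.ext fun w => funext fun k => ?_)
    -- Naturality along the `k`-th cut reads the `k`-th coordinate of `f` at level `p` off its first
    -- component.
    refine (withEnds_cobarComponent f (cutMap p k.succ.castSucc) w (0 : Fin 1)).symm.trans ?_
    refine (congr_arg _ (gapMap_cutMap p k.succ.castSucc)).trans ?_
    exact withEnds_mid x₀ x₀ (cobarComponent f p w) k
  right_inv g := by
    refine Subtype.ext (ContinuousMap.ext fun w => ?_)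
    -- The middle cut of `[1]`, its only non-constant one, is the identity.
    change g.1 ((K.map (cutMap ⦋1⦌ (1 : Fin 3))).hom w) = _
    rw [cutMap_one, K.map_id]
    rfl
  continuous_toFun := Continuous.subtype_mk
    ((ContinuousMap.continuous_postcomp (⟨fun c : Fin 1 → X => c 0, continuous_apply 0⟩ :
      C(Fin 1 → X, X))).comp
      ((continuous_apply (⦋1⦌ : SimplexCategory)).comp continuous_subtype_val)) _
  continuous_invFun := Continuous.subtype_mk (continuous_pi (continuous_cobarExtend K x₀)) _

theorem cosimplicialEnds_toTop₀ : cosimplicialEnds SimplexCategory.toTop₀ = simplexEnds := by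
  ext p
  constructor
  · rintro ⟨θ, z, rfl⟩
    refine ⟨θ.toOrderHom 0, ?_⟩
    have hz : z = stdSimplex.vertex (X := Fin 1) 0 :=
      Subsingleton.elim (α := stdSimplex ℝ (Fin 1)) _ _
    rw [hz]
    exact stdSimplex.map_vertex θ.toOrderHom 0
  · rintro ⟨τ, rfl⟩
    exact ⟨SimplexCategory.const ⦋0⦌ ⦋1⦌ τ, stdSimplex.vertex (X := Fin 1) 0,
      stdSimplex.map_vertex _ _⟩

theorem cosimplicialEnds_overNerve : cosimplicialEnds overNerve = overEnds := by
  ext p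
  constructor
  · rintro ⟨θ, z, rfl⟩
    refine ⟨θ.toOrderHom 0, z, ?_⟩
    rw [overVertex, ← hom_zero_eq_const]
    rfl
  · rintro ⟨τ, z, rfl⟩
    exact ⟨SimplexCategory.const ⦋0⦌ ⦋1⦌ τ, z, rfl⟩

theorem nonempty_tot_cobar :
    Nonempty (ContinuousMap.HomotopyEquiv (Tot (cobar X x₀)) (Path x₀ x₀)) := by
  have e := mapSpaceCobarHomeo SimplexCategory.toTop₀ x₀
  rw [cosimplicialEnds_toTop₀] at e
  exact ⟨(e.trans (relMapSimplexHomeo x₀)).toHomotopyEquiv⟩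

theorem nonempty_hoLim_cobar :
    Nonempty (ContinuousMap.HomotopyEquiv (HoLim (cobar X x₀)) (Path x₀ x₀)) := by
  have e := mapSpaceCobarHomeo overNerve x₀
  rw [cosimplicialEnds_overNerve] at e
  obtain ⟨h⟩ := nonempty_homotopyEquiv_relMap x₀
  exact ⟨(e.toHomotopyEquiv.trans h).trans (relMapSimplexHomeo x₀).toHomotopyEquiv⟩

end Cobar

/-! ### Functoriality of spaces of cosimplicial maps -/

section MapSpace

variable {K A B Δ : CosimplicialObject TopCat.{0}}

/-- Postcomposition with a map of cosimplicial spaces. -/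
def mapSpacePostcomp (K : CosimplicialObject TopCat.{0}) (φ : A ⟶ B) :
    C(MapSpace K A, MapSpace K B) where
  toFun f := ⟨fun p => (φ.app p).hom.comp (f.1 p), fun p q θ => ContinuousMap.ext fun w => by
    have h := ConcreteCategory.congr_hom (φ.naturality θ) (f.1 p w)
    refine Eq.trans h.symm ?_
    exact congr_arg (φ.app q).hom (mapSpace_apply f θ w)⟩
  continuous_toFun := Continuous.subtype_mk (continuous_pi fun p =>
    (ContinuousMap.continuous_postcomp (φ.app p).hom).comp
      ((continuous_apply p).comp continuous_subtype_val)) _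

/-- Isomorphic cosimplicial spaces have homeomorphic spaces of maps into them. -/
def mapSpaceCongr (K : CosimplicialObject TopCat.{0}) (e : A ≅ B) :
    MapSpace K A ≃ₜ MapSpace K B where
  toFun := mapSpacePostcomp K e.hom
  invFun := mapSpacePostcomp K e.inv
  left_inv f := Subtype.ext (funext fun p => ContinuousMap.ext fun w =>
    ConcreteCategory.congr_hom (e.hom_inv_id_app p) (f.1 p w))
  right_inv f := Subtype.ext (funext fun p => ContinuousMap.ext fun w =>
    ConcreteCategory.congr_hom (e.inv_hom_id_app p) (f.1 p w))
  continuous_toFun := (mapSpacePostcomp K e.hom).continuous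
  continuous_invFun := (mapSpacePostcomp K e.inv).continuous

/-- Let `φ : A ⟶ B` have a section `ψ` and a homotopy `H` from the identity to `ψ ∘ φ`, both of which
depend on a parameter in `Δ` and are natural. A cosimplicial map `K ⟶ Δ` then makes `φ` induce a
homotopy equivalence between the spaces of maps from `K`. -/
theorem nonempty_mapSpace_homotopyEquiv (κ : K ⟶ Δ) (φ : A ⟶ B)
    (ψ : ∀ p, C(B.obj p × Δ.obj p, A.obj p))
    (H : ∀ p, C(unitInterval × (A.obj p × Δ.obj p), A.obj p))
    (hψ : ∀ ⦃p q : SimplexCategory⦄ (θ : p ⟶ q) b s,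
      (A.map θ).hom (ψ p (b, s)) = ψ q ((B.map θ).hom b, (Δ.map θ).hom s))
    (hH : ∀ ⦃p q : SimplexCategory⦄ (θ : p ⟶ q) t a s,
      (A.map θ).hom (H p (t, a, s)) = H q (t, (A.map θ).hom a, (Δ.map θ).hom s))
    (hφψ : ∀ p b s, (φ.app p).hom (ψ p (b, s)) = b)
    (hH0 : ∀ p a s, H p (0, a, s) = a)
    (hH1 : ∀ p a s, H p (1, a, s) = ψ p ((φ.app p).hom a, s))
    (hA : ∀ p, Continuous fun f : C(K.obj p, A.obj p) => f.prodMk (κ.app p).hom)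
    (hB : ∀ p, Continuous fun f : C(K.obj p, B.obj p) => f.prodMk (κ.app p).hom) :
    Nonempty (ContinuousMap.HomotopyEquiv (MapSpace K A) (MapSpace K B)) := by
  have hκ : ∀ ⦃p q : SimplexCategory⦄ (θ : p ⟶ q) w,
      (Δ.map θ).hom ((κ.app p).hom w) = (κ.app q).hom ((K.map θ).hom w) := fun p q θ w =>
    (ConcreteCategory.congr_hom (κ.naturality θ) w).symm
  let back : C(MapSpace K B, MapSpace K A) :=
    { toFun := fun f => ⟨fun p => (ψ p).comp ((f.1 p).prodMk (κ.app p).hom), fun p q θ =>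
        ContinuousMap.ext fun w => by
          refine (hψ θ _ _).trans ?_
          rw [mapSpace_apply, hκ]
          rfl⟩
      continuous_toFun := Continuous.subtype_mk (continuous_pi fun p =>
        (ContinuousMap.continuous_postcomp (ψ p)).comp
          ((hB p).comp ((continuous_apply p).comp continuous_subtype_val))) _ }
  let htpy : C(unitInterval × MapSpace K A, MapSpace K A) :=
    { toFun := fun x => ⟨fun p => (H p).comp ((ContinuousMap.const _ x.1).prodMk
          ((x.2.1 p).prodMk (κ.app p).hom)), fun p q θ =>
        ContinuousMap.ext fun w => by
          refine (hH θ _ _ _).trans ?_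
          rw [mapSpace_apply, hκ]
          rfl⟩
      continuous_toFun := Continuous.subtype_mk (continuous_pi fun p =>
        (ContinuousMap.continuous_postcomp (H p)).comp
          (ContinuousMap.continuous_prodMk_const.comp (continuous_fst.prodMk
            ((hA p).comp ((continuous_apply p).comp
              (continuous_subtype_val.comp continuous_snd)))))) _ }
  refine ⟨⟨mapSpacePostcomp K φ, back, ContinuousMap.Homotopic.symm ⟨⟨htpy, fun f => ?_,
    fun f => ?_⟩⟩, ?_⟩⟩
  · exact Subtype.ext (funext fun p => ContinuousMap.ext fun w => hH0 p _ _)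
  · exact Subtype.ext (funext fun p => ContinuousMap.ext fun w => hH1 p _ _)
  · have : (mapSpacePostcomp K φ).comp back = ContinuousMap.id _ :=
      ContinuousMap.ext fun f => Subtype.ext (funext fun p => ContinuousMap.ext fun w =>
        hφψ p _ _)
    rw [this]

end MapSpace

/-! ### The last vertex map -/

theorem overNerve_map_chainMap {p q : SimplexCategory} (θ : p ⟶ q) {L : Type} [Fintype L]
    [LinearOrder L] [Nonempty L] (x : L ⥤ Over p) (s : stdSimplex ℝ L) :
    (overNerve.map θ).hom (chainMap x s) = chainMap (x ⋙ Over.map θ) s :=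
  toTop_map_chainMap (Over.map θ) x s

/-- The value at the last vertex of the objects of a chain in `Δ ↓ [p]`. -/
def lastVertex {p : SimplexCategory} {L : Type} [LinearOrder L] (x : L ⥤ Over p) (i : L) :
    Fin (p.len + 1) :=
  (x.obj i).hom.toOrderHom (Fin.last _)

/-- Any assignment of vertices to objects extends affinely and glues. The last vertex is chosen
because it is natural in `[p]`: postcomposition with `θ` applies `θ` to it. -/
theorem exists_lastVertex (p : SimplexCategory) :
    ∃ F : C(SSet.toTop.obj (nerve (Over p)), stdSimplex ℝ (Fin (p.len + 1))),
      ∀ (L : Type) [Fintype L] [LinearOrder L] [Nonempty L] (x : L ⥤ Over p) (s : stdSimplex ℝ L),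
        F (chainMap x s) = stdSimplex.map (lastVertex x) s := by
  refine exists_nerve_desc (fun L _ _ _ x => ⟨fun s => stdSimplex.map (lastVertex x) s,
    stdSimplex.continuous_map (lastVertex x)⟩) ?_
  intro L L' _ _ _ _ _ _ θ x s
  exact (stdSimplex.map_comp_apply θ (lastVertex x) s).symm

theorem nonempty_overNerve_hom : Nonempty (overNerve ⟶ SimplexCategory.toTop₀) := by
  choose F hF using exists_lastVertex
  refine ⟨{ app := fun p => TopCat.ofHom (F p), naturality := fun p q θ => ?_ }⟩
  refine TopCat.hom_ext (ContinuousMap.ext fun w => ?_)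
  change F q ((overNerve.map θ).hom w) = stdSimplex.map θ.toOrderHom (F p w)
  obtain ⟨n, x, s, rfl⟩ := exists_chainMap_eq (C := Over p) w
  refine (congr_arg (F q) (overNerve_map_chainMap θ x s)).trans ?_
  refine (hF q _ _ s).trans ?_
  refine Eq.trans ?_ (congr_arg (stdSimplex.map θ.toOrderHom) (hF p _ x s).symm)
  rw [stdSimplex.map_comp_apply]
  rfl

/-! ### Heights -/

/-- Entrywise operations that match the end points commute with the structure maps; all naturality
checks for braids reduce to this. -/
theorem withEnds_map₂ {Y Z W : Type} (f : Y → Z → W) (a b : Y) (a' b' : Z) {p : ℕ} (x : Fin p → Y)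
    (z : Fin p → Z) (j : Fin (p + 2)) :
    withEnds (f a a') (f b b') (fun k => f (x k) (z k)) j =
      f (withEnds a b x j) (withEnds a' b' z j) := by
  rcases end_cases j with rfl | rfl | ⟨k, rfl⟩
  · simp only [withEnds_zero]
  · simp only [withEnds_last]
  · simp only [withEnds_mid]

theorem withEnds_map {Y W : Type} (f : Y → W) (a b : Y) {p : ℕ} (x : Fin p → Y)
    (j : Fin (p + 2)) :
    withEnds (f a) (f b) (fun k => f (x k)) j = f (withEnds a b x j) :=
  withEnds_map₂ (fun y (_ : Unit) => f y) a b () () x (fun _ => ()) j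

/-- The sum of the barycentric coordinates with index less than `g`. -/
def partialSum {p : ℕ} (s : stdSimplex ℝ (Fin (p + 1))) (g : ℕ) : unitInterval :=
  ⟨∑ i ∈ Finset.univ.filter fun i : Fin (p + 1) => (i : ℕ) < g, s i,
    Finset.sum_nonneg fun i _ => s.2.1 i, by
    rw [← stdSimplex.sum_eq_one s]
    exact Finset.sum_le_sum_of_subset_of_nonneg (Finset.filter_subset _ _) fun i _ _ => s.2.1 i⟩

theorem partialSum_mono {p : ℕ} (s : stdSimplex ℝ (Fin (p + 1))) : Monotone (partialSum s) := by
  intro g g' h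
  refine Subtype.coe_le_coe.1 ?_
  simp only [partialSum]
  refine Finset.sum_le_sum_of_subset_of_nonneg (fun i hi => ?_) fun i _ _ => s.2.1 i
  simp only [Finset.mem_filter, Finset.mem_univ, true_and] at hi ⊢
  omega

theorem continuous_partialSum {p : ℕ} (g : ℕ) :
    Continuous fun s : stdSimplex ℝ (Fin (p + 1)) => partialSum s g :=
  Continuous.subtype_mk (continuous_finsetSum _ fun i _ => continuous_stdSimplex_apply i) _

/-- `stdSimplex.map` pushes mass forward: the mass below `j` comes from the `i` with `θ i < j`,
which are the `i` below `gapMap θ j`. -/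
theorem partialSum_map {p q : SimplexCategory} (θ : p ⟶ q) (s : stdSimplex ℝ (Fin (p.len + 1)))
    (j : Fin (q.len + 2)) :
    partialSum (stdSimplex.map θ.toOrderHom s) j = partialSum s (gapMap θ j) := by
  ext
  simp only [partialSum, stdSimplex_map_apply]
  simp_rw [lt_gapMap_iff]
  rw [← Finset.sum_fiberwise_of_maps_to (s := Finset.univ.filter fun i : Fin (p.len + 1) =>
    (θ.toOrderHom i : ℕ) < j) (t := Finset.univ.filter fun i : Fin (q.len + 1) => (i : ℕ) < j)
    (g := θ.toOrderHom) (by simp)]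
  refine Finset.sum_congr rfl fun i hi => Finset.sum_congr ?_ fun _ _ => rfl
  ext l
  simp only [Finset.mem_filter, Finset.mem_univ, true_and] at hi ⊢
  constructor
  · rintro rfl
    exact ⟨hi, rfl⟩
  · exact fun h => h.2

/-- The increasing heights given by a point of the simplex. -/
def heights {p : ℕ} (s : stdSimplex ℝ (Fin (p + 1))) (j : Fin p) : unitInterval :=
  partialSum s (j + 1)

theorem heights_mono {p : ℕ} (s : stdSimplex ℝ (Fin (p + 1))) : Monotone (heights s) :=
  fun _ _ h => partialSum_mono s (Nat.succ_le_succ h)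

theorem withEnds_heights {p : ℕ} (s : stdSimplex ℝ (Fin (p + 1))) (j : Fin (p + 2)) :
    withEnds 0 1 (heights s) j = partialSum s j := by
  rcases end_cases j with rfl | rfl | ⟨k, rfl⟩
  · rw [withEnds_zero]
    ext
    simp [partialSum]
  · rw [withEnds_last]
    ext
    simp only [partialSum, Fin.val_last]
    rw [Finset.filter_true_of_mem fun i _ => i.isLt, stdSimplex.sum_eq_one]
    rfl
  · rw [withEnds_mid]
    rfl

/-- The heights thus form a cosimplicial map from `Δ^•` to tuples with end points `0` and `1`. -/
theorem withEnds_heights_gapMap {p q : SimplexCategory} (θ : p ⟶ q)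
    (s : stdSimplex ℝ (Fin (p.len + 1))) (k : Fin q.len) :
    withEnds 0 1 (heights s) (gapMap θ k.succ.castSucc) =
      heights (stdSimplex.map θ.toOrderHom s) k := by
  rw [withEnds_heights, ← partialSum_map]
  rfl

/-- The point of the unit interval dividing the segment from `a` to `b` at time `t`. -/
def segmentHeight (t a b : unitInterval) : unitInterval :=
  ⟨(1 - t) * a + t * b, by
    have h := sub_nonneg.2 t.2.2
    exact add_nonneg (mul_nonneg h a.2.1) (mul_nonneg t.2.1 b.2.1), by
    nlinarith [mul_le_mul_of_nonneg_left a.2.2 (sub_nonneg.2 t.2.2),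
      mul_le_mul_of_nonneg_left b.2.2 t.2.1]⟩

theorem segmentHeight_zero (a b : unitInterval) : segmentHeight 0 a b = a := by
  ext; simp [segmentHeight]

theorem segmentHeight_one (a b : unitInterval) : segmentHeight 1 a b = b := by
  ext; simp [segmentHeight]

/-- Keeps the inserted heights `0` and `1` in place during the homotopy, so that it respects the
outer cofaces. -/
theorem segmentHeight_self (t a : unitInterval) : segmentHeight t a a = a := by
  ext; simp only [segmentHeight]; ring

theorem segmentHeight_mono (t : unitInterval) {a a' b b' : unitInterval} (ha : a ≤ a')
    (hb : b ≤ b') : segmentHeight t a b ≤ segmentHeight t a' b' :=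
  Subtype.coe_le_coe.1 (add_le_add (mul_le_mul_of_nonneg_left ha (sub_nonneg.2 t.2.2))
    (mul_le_mul_of_nonneg_left hb t.2.1))

theorem continuous_segmentHeight :
    Continuous fun x : unitInterval × unitInterval × unitInterval =>
      segmentHeight x.1 x.2.1 x.2.2 :=
  Continuous.subtype_mk (by fun_prop) _

/-! ### The braid models -/

section Braids

variable {k m : ℕ} (y : Conf m (Cube k))

/-- The `p`-th space of the cosimplicial model for braids. -/
abbrev BraidSpace (k m p : ℕ) : Type := 
  {x : Fin m → Fin p → Cube k // IsColumnwiseConf x}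

/-- The `p`-th space of the diagonal model for braids. -/
abbrev LevelBraidSpace (k m p : ℕ) : Type :=
  
  {x : Fin m → Fin p → Cube k × unitInterval // IsColumnwiseConf x ∧ IsLevel x ∧ IsRising x}

/-- The columns of a braid as configurations. -/
def braidSpaceHomeo (k m p : ℕ) : BraidSpace k m p ≃ₜ (Fin p → Conf m (Cube k)) where
  toFun x j := ⟨fun i => x.1 i j, x.2 j⟩
  invFun c := ⟨fun i j => (c j).1 i, fun j => (c j).2⟩
  left_inv _ := rfl
  right_inv _ := rfl
  continuous_toFun := continuous_pi fun j => Continuous.subtype_mk (continuous_pi fun i =>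
    (continuous_apply j).comp ((continuous_apply i).comp continuous_subtype_val)) _
  continuous_invFun := Continuous.subtype_mk (continuous_pi fun i => continuous_pi fun j => by
    have h : Continuous fun c : Fin p → Conf m (Cube k) => (c j).1 :=
      continuous_subtype_val.comp (continuous_apply j)
    exact (continuous_apply i).comp h) _

/-- The cosimplicial model for braids is the cobar construction on the configuration space. -/
def braidModelIso : braidModel y ≅ cobar (Conf m (Cube k)) y :=
  NatIso.ofComponents (fun p => TopCat.isoOfHomeo (braidSpaceHomeo k m p.len)) fun {p q} θ => by
    refine TopCat.hom_ext (ContinuousMap.ext fun x => funext fun j =>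
      Subtype.ext (funext fun i => ?_))
    exact withEnds_map (fun c : Conf m (Cube k) => c.1 i) y y (braidSpaceHomeo k m p.len x)
      (gapMap θ j.succ.castSucc)

/-- The columns of a level braid, projected to `I^k`. -/
def forgetHeights (k m p : ℕ) : C(LevelBraidSpace k m p, Fin p → Conf m (Cube k)) where
  toFun x j := ⟨fun i => (x.1 i j).1, fun i i' h => x.2.1 j (Prod.ext h (x.2.2.1 i i' j))⟩
  continuous_toFun := continuous_pi fun j => Continuous.subtype_mk (continuous_pi fun i =>
    continuous_fst.comp ((continuous_apply j).comp
      ((continuous_apply i).comp continuous_subtype_val))) _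

/-- The level braid with the given columns and heights. -/
def attachHeights (k m p : ℕ) :
    C((Fin p → Conf m (Cube k)) × stdSimplex ℝ (Fin (p + 1)), LevelBraidSpace k m p) where
  toFun x := ⟨fun i j => ((x.1 j).1 i, heights x.2 j),
    fun j _ _ h => (x.1 j).2 (congr_arg Prod.fst h), fun _ _ _ => rfl,
    fun _ => heights_mono x.2⟩
  continuous_toFun := Continuous.subtype_mk (continuous_pi fun i => continuous_pi fun j => by
    have h : Continuous fun x : (Fin p → Conf m (Cube k)) × stdSimplex ℝ (Fin (p + 1)) =>
        (x.1 j).1 := continuous_subtype_val.comp ((continuous_apply j).comp continuous_fst)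
    exact ((continuous_apply i).comp h).prodMk
      ((continuous_partialSum (j + 1)).comp continuous_snd)) _

/-- The motion of the slices of a level braid to given heights. -/
def moveHeights (k m p : ℕ) :
    C(unitInterval × (LevelBraidSpace k m p × stdSimplex ℝ (Fin (p + 1))),
      LevelBraidSpace k m p) where
  toFun x := ⟨fun i j => ((x.2.1.1 i j).1, segmentHeight x.1 (x.2.1.1 i j).2 (heights x.2.2 j)),
    fun j i i' h => x.2.1.2.1 j (Prod.ext (Prod.ext_iff.1 h).1 (x.2.1.2.2.1 i i' j)),
    fun i i' j => congr_arg (fun a => segmentHeight x.1 a (heights x.2.2 j)) (x.2.1.2.2.1 i i' j),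
    fun i _ _ h => segmentHeight_mono x.1 (x.2.1.2.2.2 i h) (heights_mono x.2.2 h)⟩
  continuous_toFun := Continuous.subtype_mk (continuous_pi fun i => continuous_pi fun j => by
    have h : Continuous fun x : unitInterval × (LevelBraidSpace k m p ×
        stdSimplex ℝ (Fin (p + 1))) => x.2.1.1 i j :=
      (continuous_apply j).comp ((continuous_apply i).comp
        (continuous_subtype_val.comp (continuous_fst.comp continuous_snd)))
    exact (continuous_fst.comp h).prodMk (continuous_segmentHeight.comp
      (continuous_fst.prodMk ((continuous_snd.comp h).prodMk
        ((continuous_partialSum (j + 1)).comp (continuous_snd.comp continuous_snd)))))) _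

theorem moveHeights_zero (k m p : ℕ) (x : LevelBraidSpace k m p)
    (s : stdSimplex ℝ (Fin (p + 1))) : moveHeights k m p (0, x, s) = x :=
  Subtype.ext (funext fun _ => funext fun _ => Prod.ext rfl (segmentHeight_zero _ _))

theorem moveHeights_one (k m p : ℕ) (x : LevelBraidSpace k m p)
    (s : stdSimplex ℝ (Fin (p + 1))) :
    moveHeights k m p (1, x, s) = attachHeights k m p (forgetHeights k m p x, s) :=
  Subtype.ext (funext fun _ => funext fun _ => Prod.ext rfl (segmentHeight_one _ _))

theorem forgetHeights_attachHeights (k m p : ℕ) (c : Fin p → Conf m (Cube k))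
    (s : stdSimplex ℝ (Fin (p + 1))) : forgetHeights k m p (attachHeights k m p (c, s)) = c := rfl

/-- The map from the diagonal model for braids to the cobar construction that forgets heights. -/
def diagonalToCobar : diagonalBraidModel y ⟶ cobar (Conf m (Cube k)) y where
  app p := TopCat.ofHom (forgetHeights k m p.len)
  naturality p q θ := by
    refine TopCat.hom_ext (ContinuousMap.ext fun x => funext fun j =>
      Subtype.ext (funext fun i => ?_))
    change Prod.fst (withEnds (bottomPt y i) (topPt y i) (x.1 i) (gapMap θ j.succ.castSucc)) =
      (withEnds y y (forgetHeights k m p.len x) (gapMap θ j.succ.castSucc)).1 i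
    refine (withEnds_map Prod.fst (bottomPt y i) (topPt y i) (x.1 i) _).symm.trans ?_
    exact withEnds_map (fun c : Conf m (Cube k) => c.1 i) y y (forgetHeights k m p.len x) _

theorem isLevelwiseHomotopyEquiv_diagonalToCobar :
    IsLevelwiseHomotopyEquiv (diagonalToCobar y) := fun p => by
  -- A single level imposes no naturality, so any fixed point of the simplex serves as parameter.
  let s : stdSimplex ℝ (Fin (p.len + 1)) := stdSimplex.vertex 0
  let back : C(Fin p.len → Conf m (Cube k), LevelBraidSpace k m p.len) :=
    (attachHeights k m p.len).comp (ContinuousMap.prodMk (ContinuousMap.id _)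
      (ContinuousMap.const _ s))
  refine ⟨⟨forgetHeights k m p.len, back, ContinuousMap.Homotopic.symm
    ⟨⟨(moveHeights k m p.len).comp (ContinuousMap.prodMk ContinuousMap.fst
      (ContinuousMap.prodMk ContinuousMap.snd (ContinuousMap.const _ s))), fun x => ?_,
      fun x => ?_⟩⟩, ContinuousMap.Homotopic.refl _⟩, rfl⟩
  · exact moveHeights_zero k m p.len x s
  · exact moveHeights_one k m p.len x s

/-- Attaching and moving heights are natural once the simplex parameter moves along, and `κ`
provides that parameter. -/
theorem nonempty_mapSpace_diagonal {K : CosimplicialObject TopCat.{0}}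
    (κ : K ⟶ SimplexCategory.toTop₀) :
    Nonempty (ContinuousMap.HomotopyEquiv (MapSpace K (diagonalBraidModel y))
      (MapSpace K (cobar (Conf m (Cube k)) y))) := by
  refine nonempty_mapSpace_homotopyEquiv κ (diagonalToCobar y) (fun p => attachHeights k m p.len)
    (fun p => moveHeights k m p.len) ?_ ?_ (fun p => forgetHeights_attachHeights k m p.len)
    (fun p => moveHeights_zero k m p.len) (fun p => moveHeights_one k m p.len) ?_ ?_
  · intro p q θ c s
    refine Subtype.ext (funext fun i => funext fun j => ?_)
    change withEnds (bottomPt y i) (topPt y i) (fun l => ((c l).1 i, heights s l))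
      (gapMap θ j.succ.castSucc) = ((withEnds y y c (gapMap θ j.succ.castSucc)).1 i,
        heights (stdSimplex.map θ.toOrderHom s) j)
    refine Eq.trans ?_ (congr_arg (Prod.mk _) (withEnds_heights_gapMap θ s j))
    exact withEnds_map₂ (fun (c : Conf m (Cube k)) (r : unitInterval) => (c.1 i, r)) y y 0 1 c
      (heights s) _
  · intro p q θ t x s
    refine Subtype.ext (funext fun i => funext fun j => ?_)
    let f : Cube k × unitInterval → unitInterval → Cube k × unitInterval :=
      fun u r => (u.1, segmentHeight t u.2 r)
    -- Both strand ends are fixed by the motion, since the target heights there are also `0` and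
    -- `1`.
    have h0 : f (bottomPt y i) 0 = bottomPt y i := Prod.ext rfl (segmentHeight_self t 0)
    have h1 : f (topPt y i) 1 = topPt y i := Prod.ext rfl (segmentHeight_self t 1)
    change withEnds (bottomPt y i) (topPt y i) (fun l => f (x.1 i l) (heights s l))
      (gapMap θ j.succ.castSucc) = f (withEnds (bottomPt y i) (topPt y i) (x.1 i)
        (gapMap θ j.succ.castSucc)) (heights (stdSimplex.map θ.toOrderHom s) j)
    refine Eq.trans ?_ (congr_arg (f _) (withEnds_heights_gapMap θ s j))
    refine Eq.trans ?_ (withEnds_map₂ f _ _ 0 1 _ _ _)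
    rw [h0, h1]
  -- Naming the spaces as subtypes and products of cubes makes their uniform structures available.
  · exact fun p => continuous_prodMk_mapSpace (A := LevelBraidSpace k m p.len)
      (B := stdSimplex ℝ (Fin (p.len + 1))) continuous_id continuous_const
  · exact fun p => continuous_prodMk_mapSpace (A := Fin p.len → Conf m (Cube k))
      (B := stdSimplex ℝ (Fin (p.len + 1))) continuous_id continuous_const

end Braids

end

/-! ### Assembly for both totalizations -/

theorem propositionP (n m : ℕ) (hn : 2 ≤ n) (y : Conf m (Cube (n - 1))) :
    Nonempty (braidModel y ≅ cobar (Conf m (Cube (n - 1))) y) ∧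
    (∃ φ : diagonalBraidModel y ⟶ cobar (Conf m (Cube (n - 1))) y, IsLevelwiseHomotopyEquiv φ) ∧
    Nonempty (ContinuousMap.HomotopyEquiv (Tot (braidModel y)) (Path y y)) ∧
    Nonempty (ContinuousMap.HomotopyEquiv (Tot (diagonalBraidModel y)) (Path y y)) ∧
    Nonempty (ContinuousMap.HomotopyEquiv (HoLim (braidModel y)) (Path y y)) ∧
    Nonempty (ContinuousMap.HomotopyEquiv (HoLim (diagonalBraidModel y)) (Path y y)) := by
  obtain ⟨tot⟩ := nonempty_tot_cobar y
  obtain ⟨hoLim⟩ := nonempty_hoLim_cobar y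
  obtain ⟨κ⟩ := nonempty_overNerve_hom
  -- For `Tot` the simplex parameter is the point of `Δ^p` itself; for the homotopy limit it is the
  -- image under `κ`, obtained from last vertices.
  obtain ⟨e⟩ := nonempty_mapSpace_diagonal y (𝟙 SimplexCategory.toTop₀)
  obtain ⟨e'⟩ := nonempty_mapSpace_diagonal y κ
  exact ⟨⟨braidModelIso y⟩, ⟨_, isLevelwiseHomotopyEquiv_diagonalToCobar y⟩,
    ⟨(mapSpaceCongr _ (braidModelIso y)).toHomotopyEquiv.trans tot⟩, ⟨e.trans tot⟩,
    ⟨(mapSpaceCongr _ (braidModelIso y)).toHomotopyEquiv.trans hoLim⟩, ⟨e'.trans hoLim⟩⟩
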